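/- Let $m>1$. Let $\mathrm{Vec}\,\mathbb R^m=\mathrm{Span}_{\mathbb C}\{x^JD_i: 1\le i\le m,\ J\in\mathbb N^m\}$, $D_i=\partial/\partial x_i$, be the complex Lie algebra of polynomial vector fields on $\mathbb R^m$, let $E=\sum_i x_iD_i$, and consider its Lie subalgebras $$\mathfrak u_m=\mathrm{Span}\{D_i\},\quad \mathfrak l_m=\mathrm{Span}\{x_jD_i\},\quad \mathfrak b_m=\mathfrak u_m\oplus\mathfrak l_m,\quad \mathfrak a_m=\mathrm{Span}\{D_i,\,x_jD_i,\,x_jE\}.$$ For $\lambda\in\mathbb C^m$ let $L(\lambda)$ be the irreducible $\mathfrak l_m$-module of lowest weight $\lambda$: it contains a nonzero vector on which $x_iD_i$ acts by $\lambda_i$ for every $i$ and which is annihilated by $x_jD_i$ for all $i<j$. For an $\mathfrak l_m$-module $V$ let $F(V)=\mathbb C[x_1,\dots,x_m]\otimes V$ be the module of polynomial $V$-valued tensor fields, on which $X=\sum_i f_iD_i$ acts by $$X\cdot(p\otimes v)=X(p)\otimes v+\sum_{i,j}\frac{\partial f_i}{\partial x_j}\,p\otimes (x_jD_i)v .$$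 For Lie subalgebras $\mathfrak h\subseteq\mathfrak k$ of $\mathrm{Vec}\,\mathbb R^m$ and a $\mathrm{Vec}\,\mathbb R^m$-module $M$, an $\mathfrak h$-relative, $\mathfrak k$-covariant 1-cocycle is a linear map $\omega:\mathrm{Vec}\,\mathbb R^m\to M$ with $\omega|_{\mathfrak h}=0$, with $\omega([Y,X])=Y\omega(X)$ for $Y\in\mathfrak k$ and all $X$, and with $\omega([X,Y])=X\omega(Y)-Y\omega(X)$ for all $X,Y$. The $\mathfrak h$-relative, $\mathfrak k$-covariant 1-cohomology is the space of these cocycles modulo the coboundaries $X\mapsto Xv$ of the $\mathfrak k$-invariant vectors $v\in M$. If $\mathfrak h=\mathfrak k$ one says simply $\mathfrak h$-relative. Then the $\mathfrak u_m$-relative, $\mathfrak b_m$-covariant 1-cohomology of $\mathrm{Vec}\,\mathbb R^m$ with values in $F(L(\lambda))$ is 1-dimensional if $\lambda=0$, $\lambda=e_m$ or $\lambda=2e_m-e_1$, where $e_i$ denotes the $i$-th standard basis vector of $\mathbb C^m$, and it is zero for all other $\lambda\in\mathbb C^m$. Moreover: - for $\lambda=0$, identifying $L(0)$ with the trivial module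 $\mathbb C$, it is spanned by the class of the divergence cocycle $\mathrm{Div}:\sum_i f_iD_i\mapsto\sum_i\partial f_i/\partial x_i$; in particular $\mathrm{Div}(E)=m$; - for $\lambda=e_m$, every $\mathfrak u_m$-relative, $\mathfrak b_m$-covariant 1-cocycle is $\mathfrak b_m$-relative; - for $\lambda=2e_m-e_1$, every $\mathfrak u_m$-relative, $\mathfrak b_m$-covariant 1-cocycle is $\mathfrak a_m$-relative. -/

import Mathlib

open scoped TensorProduct

noncomputable section

namespace VecCohomology

open MvPolynomial

/-- The Lie algebra of vector fields on `ℝ^m` with complex polynomial coefficients,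
`∑ i, f i * D i`, realised as the derivations of `ℂ[x_1, ..., x_m]`. The coefficient `f i` of
a field `Y` is `Y (X i)`, and `D i` is `pderiv i`. -/
abbrev Vec (m : ℕ) : Type :=
  Derivation ℂ (MvPolynomial (Fin m) ℂ) (MvPolynomial (Fin m) ℂ)

/-- The linear span of a set whose pairwise brackets lie in that span, as a Lie subalgebra. -/
def spanSubalgebra {L : Type*} [LieRing L] [LieAlgebra ℂ L] (S : Set L)
    (h : ∀ x ∈ S, ∀ y ∈ S, ⁅x, y⁆ ∈ Submodule.span ℂ S) : LieSubalgebra ℂ L where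
  toSubmodule := Submodule.span ℂ S
  lie_mem' := by
    intro x y hx hy
    change x ∈ Submodule.span ℂ S at hx
    change y ∈ Submodule.span ℂ S at hy
    change ⁅x, y⁆ ∈ Submodule.span ℂ S
    induction hx using Submodule.span_induction with
    | mem x hxS =>
      induction hy using Submodule.span_induction with
      | mem y hyS => exact h x hxS y hyS
      | zero => simp
      | add y z _ _ h1 h2 => rw [lie_add]; exact add_mem h1 h2
      | smul c y _ h1 => rw [lie_smul]; exact Submodule.smul_mem _ c h1
    | zero => simp
    | add x z _ _ h1 h2 => rw [add_lie]; exact add_mem h1 h2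
    | smul c x _ h1 => rw [smul_lie]; exact Submodule.smul_mem _ c h1

variable {m : ℕ}

/-- The constant field `D_i`. -/
def D (i : Fin m) : Vec m := pderiv i

/-- The linear field `x_j D_i`. -/
def xD (j i : Fin m) : Vec m := (X j : MvPolynomial (Fin m) ℂ) • pderiv i

/-- The Euler field `E = ∑ i, x_i D_i`. -/
def euler (m : ℕ) : Vec m := ∑ i, xD i i

/-- The quadratic field `x_j E`. -/
def xE (j : Fin m) : Vec m := (X j : MvPolynomial (Fin m) ℂ) • euler m

lemma D_X (i k : Fin m) : D i (X k) = if k = i then 1 else 0 := by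
  simp [D, pderiv_X, Pi.single_apply]

lemma xD_X (j i k : Fin m) : xD j i (X k) = if k = i then X j else 0 := by
  simp [xD, pderiv_X, Pi.single_apply]

lemma euler_X (k : Fin m) : euler m (X k) = X k := by
  have h : euler m (X k) = ∑ i, xD i i (X k) := by
    rw [euler, ← Derivation.coeFnAddMonoidHom_apply, map_sum, Finset.sum_apply]
    rfl
  simp [h, xD_X]

lemma xE_X (j k : Fin m) : xE j (X k) = X j * X k := by
  simp [xE, euler_X]

lemma lie_D_D (i j : Fin m) : ⁅D i, D j⁆ = 0 := by
  apply derivation_ext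
  intro k
  simp only [Derivation.commutator_apply, D_X]
  split_ifs <;> simp

lemma lie_D_xD (k j i : Fin m) : ⁅D k, xD j i⁆ = if j = k then D i else 0 := by
  apply derivation_ext
  intro l
  simp only [Derivation.commutator_apply, D_X, xD_X]
  split_ifs <;> simp_all [D_X]

lemma lie_xD_xD (j i l k : Fin m) :
    ⁅xD j i, xD l k⁆ = (if l = i then xD j k else 0) - (if j = k then xD l i else 0) := by
  apply derivation_ext
  intro n
  simp only [Derivation.commutator_apply, Derivation.sub_apply, xD_X]
  split_ifs <;> simp_all [xD_X]

lemma lie_D_xE (i j : Fin m) :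
    ⁅D i, xE j⁆ = (if j = i then euler m else 0) + xD j i := by
  apply derivation_ext
  intro k
  simp only [Derivation.commutator_apply, Derivation.add_apply, D_X, xD_X, xE_X,
    Derivation.leibniz, smul_eq_mul]
  split_ifs <;> simp_all [euler_X]

lemma lie_xD_xE (j i k : Fin m) : ⁅xD j i, xE k⁆ = if k = i then xE j else 0 := by
  apply derivation_ext
  intro l
  simp only [Derivation.commutator_apply, xD_X, xE_X, Derivation.leibniz, smul_eq_mul]
  split_ifs <;> simp_all [xE_X, mul_comm]

lemma lie_xE_xE (i j : Fin m) : ⁅xE i, xE j⁆ = 0 := by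
  apply derivation_ext
  intro l
  simp only [Derivation.commutator_apply, xE_X, Derivation.leibniz, smul_eq_mul,
    Derivation.zero_apply]
  ring

/-- The constant fields `D_i`. -/
def constSet (m : ℕ) : Set (Vec m) := Set.range D

/-- The linear fields `x_j D_i`. -/
def linSet (m : ℕ) : Set (Vec m) := Set.range fun p : Fin m × Fin m => xD p.1 p.2

/-- The quadratic fields `x_j E`. -/
def quadSet (m : ℕ) : Set (Vec m) := Set.range xE

/-- The constant algebra `u_m = span {D_i}`. -/
def constAlg (m : ℕ) : LieSubalgebra ℂ (Vec m) :=
  spanSubalgebra (constSet m) (by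
    rintro _ ⟨i, rfl⟩ _ ⟨j, rfl⟩
    rw [lie_D_D]
    exact zero_mem _)

/-- The linear algebra `l_m = span {x_j D_i}`, a copy of `gl_m`. -/
def linAlg (m : ℕ) : LieSubalgebra ℂ (Vec m) :=
  spanSubalgebra (linSet m) (by
    rintro _ ⟨⟨j, i⟩, rfl⟩ _ ⟨⟨l, k⟩, rfl⟩
    have h : ∀ a b : Fin m, xD a b ∈ Submodule.span ℂ (linSet m) := fun a b =>
      Submodule.subset_span ⟨(a, b), rfl⟩
    simp only [lie_xD_xD]
    split_ifs <;> simp [h, sub_mem])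

/-- The affine algebra `b_m = span {D_i, x_j D_i}`. -/
def affAlg (m : ℕ) : LieSubalgebra ℂ (Vec m) :=
  spanSubalgebra (constSet m ∪ linSet m) (by
    have h : ∀ a b : Fin m, xD a b ∈ Submodule.span ℂ (constSet m ∪ linSet m) := fun a b =>
      Submodule.subset_span (Or.inr ⟨(a, b), rfl⟩)
    have h0 : ∀ a : Fin m, D a ∈ Submodule.span ℂ (constSet m ∪ linSet m) := fun a =>
      Submodule.subset_span (Or.inl ⟨a, rfl⟩)
    rintro _ (⟨i, rfl⟩ | ⟨⟨j, i⟩, rfl⟩) _ (⟨k, rfl⟩ | ⟨⟨l, k⟩, rfl⟩)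
    · rw [lie_D_D]; exact zero_mem _
    · simp only [lie_D_xD]; split_ifs <;> simp [-Submodule.span_union, h0]
    · rw [← lie_skew]; simp only [lie_D_xD]; split_ifs <;> simp [-Submodule.span_union, h0]
    · simp only [lie_xD_xD]; split_ifs <;> simp [-Submodule.span_union, h, sub_mem])

/-- The projective algebra `a_m = span {D_i, x_j D_i, x_j E}`, a copy of `sl_{m+1}`. -/
def projAlg (m : ℕ) : LieSubalgebra ℂ (Vec m) :=
  spanSubalgebra (constSet m ∪ linSet m ∪ quadSet m) (by
    have h : ∀ a b : Fin m, xD a b ∈ Submodule.span ℂ (constSet m ∪ linSet m ∪ quadSet m) :=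
      fun a b => Submodule.subset_span (Or.inl (Or.inr ⟨(a, b), rfl⟩))
    have h0 : ∀ a : Fin m, D a ∈ Submodule.span ℂ (constSet m ∪ linSet m ∪ quadSet m) :=
      fun a => Submodule.subset_span (Or.inl (Or.inl ⟨a, rfl⟩))
    have h2 : ∀ a : Fin m, xE a ∈ Submodule.span ℂ (constSet m ∪ linSet m ∪ quadSet m) :=
      fun a => Submodule.subset_span (Or.inr ⟨a, rfl⟩)
    have hE : euler m ∈ Submodule.span ℂ (constSet m ∪ linSet m ∪ quadSet m) :=
      sum_mem fun a _ => h a a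
    rintro _ ((⟨i, rfl⟩ | ⟨⟨j, i⟩, rfl⟩) | ⟨i, rfl⟩) _ ((⟨k, rfl⟩ | ⟨⟨l, k⟩, rfl⟩) | ⟨k, rfl⟩)
    · rw [lie_D_D]; exact zero_mem _
    · simp only [lie_D_xD]; split_ifs <;> simp [-Submodule.span_union, h0]
    · simp only [lie_D_xE]; split_ifs <;> simp [-Submodule.span_union, h, hE, add_mem]
    · rw [← lie_skew]; simp only [lie_D_xD]; split_ifs <;> simp [-Submodule.span_union, h0]
    · simp only [lie_xD_xD]; split_ifs <;> simp [-Submodule.span_union, h, sub_mem]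
    · simp only [lie_xD_xE]; split_ifs <;> simp [-Submodule.span_union, h2]
    · rw [← lie_skew, neg_mem_iff]; simp only [lie_D_xE]; split_ifs <;> simp [-Submodule.span_union, h, hE, add_mem]
    · rw [← lie_skew, neg_mem_iff]; simp only [lie_xD_xE]; split_ifs <;> simp [-Submodule.span_union, h2]
    · rw [lie_xE_xE]; exact zero_mem _)

/-- `x_j D_i` as an element of `l_m`. -/
def linElt (j i : Fin m) : linAlg m :=
  ⟨xD j i, Submodule.subset_span ⟨(j, i), rfl⟩⟩

lemma lie_linElt (j i l k : Fin m) :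
    ⁅linElt j i, linElt l k⁆ =
      (if l = i then linElt j k else 0) - (if j = k then linElt l i else 0) := by
  apply Subtype.ext
  rw [LieSubalgebra.coe_bracket]
  change ⁅xD j i, xD l k⁆ = _
  rw [lie_xD_xD]
  split_ifs <;> simp [linElt]

section TensorFields

variable {V : Type*} [AddCommGroup V] [Module ℂ V]

/-- The module `F(V)` of polynomial sections of the bundle over `ℝ^m` with fibre `V`:
the polynomial functions with values in `V`. -/
def TensorField (m : ℕ) (V : Type*) [AddCommGroup V] [Module ℂ V] : Type _ :=
  MvPolynomial (Fin m) ℂ ⊗[ℂ] V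

instance : AddCommGroup (TensorField m V) :=
  inferInstanceAs (AddCommGroup (MvPolynomial (Fin m) ℂ ⊗[ℂ] V))

instance : Module ℂ (TensorField m V) :=
  inferInstanceAs (Module ℂ (MvPolynomial (Fin m) ℂ ⊗[ℂ] V))

/-- The tensor field `p ⊗ v`, i.e. `x ↦ p(x) v`. -/
def TensorField.mk (p : MvPolynomial (Fin m) ℂ) (v : V) : TensorField m V := p ⊗ₜ[ℂ] v

lemma TensorField.mk_add_left (p q : MvPolynomial (Fin m) ℂ) (v : V) :
    TensorField.mk (p + q) v = TensorField.mk p v + TensorField.mk q v :=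
  TensorProduct.add_tmul p q v

lemma TensorField.mk_smul_left (c : ℂ) (p : MvPolynomial (Fin m) ℂ) (v : V) :
    TensorField.mk (c • p) v = c • TensorField.mk p v := rfl

lemma TensorField.mk_add_right (p : MvPolynomial (Fin m) ℂ) (v w : V) :
    TensorField.mk p (v + w) = TensorField.mk p v + TensorField.mk p w :=
  TensorProduct.tmul_add p v w

lemma TensorField.mk_sub_left (p q : MvPolynomial (Fin m) ℂ) (v : V) :
    TensorField.mk (p - q) v = TensorField.mk p v - TensorField.mk q v :=
  TensorProduct.sub_tmul p q v

lemma TensorField.mk_sub_right (p : MvPolynomial (Fin m) ℂ) (v w : V) :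
    TensorField.mk p (v - w) = TensorField.mk p v - TensorField.mk p w :=
  TensorProduct.tmul_sub p v w

lemma TensorField.mk_sum_left {ι : Type*} (s : Finset ι) (p : ι → MvPolynomial (Fin m) ℂ)
    (v : V) : TensorField.mk (∑ i ∈ s, p i) v = ∑ i ∈ s, TensorField.mk (p i) v :=
  TensorProduct.sum_tmul s p v

lemma TensorField.mk_zero_right (p : MvPolynomial (Fin m) ℂ) :
    TensorField.mk p (0 : V) = 0 :=
  TensorProduct.tmul_zero V p

@[elab_as_elim]
lemma TensorField.induction {P : TensorField m V → Prop} (t : TensorField m V)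
    (h0 : P 0) (h1 : ∀ p v, P (TensorField.mk p v)) (h2 : ∀ s t, P s → P t → P (s + t)) : P t :=
  TensorProduct.induction_on (motive := P) t h0 h1 h2

end TensorFields

section Modules

variable (V : Type*) [AddCommGroup V] [Module ℂ V] [LieRingModule (linAlg m) V]
  [LieModule ℂ (linAlg m) V]

/-- `V` is (a copy of) `L(lam)`: an irreducible `l_m`-module with a lowest weight vector of
weight `lam`, that is a nonzero vector on which each `x_i D_i` acts by `lam i` and which is
annihilated by `x_j D_i` for `i < j`. Finite dimensionality of `V` is not required. -/
structure IsLowestWeightIrreducible (lam : Fin m → ℂ) : Prop where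
  irreducible : LieModule.IsIrreducible ℂ (linAlg m) V
  exists_lowest : ∃ v : V, v ≠ 0 ∧
    (∀ i : Fin m, ⁅linElt i i, v⁆ = lam i • v) ∧
    ∀ i j : Fin m, i < j → ⁅linElt j i, v⁆ = 0

/-- The Lie derivative of tensor fields of type `V` along a vector field `Y = ∑ i, f i * D i`:
`p ⊗ v ↦ Y(p) ⊗ v + ∑ i j, (∂f_i/∂x_j) p ⊗ (x_j D_i) v`. -/
def lieDer (Y : Vec m) : Module.End ℂ (TensorField m V) :=
  (LinearMap.rTensor V (Y : MvPolynomial (Fin m) ℂ →ₗ[ℂ] MvPolynomial (Fin m) ℂ) +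
    ∑ i, ∑ j, TensorProduct.map (LinearMap.mulLeft ℂ (pderiv j (Y (X i))))
      (LieModule.toEnd ℂ (linAlg m) V (linElt j i)) :
    MvPolynomial (Fin m) ℂ ⊗[ℂ] V →ₗ[ℂ] MvPolynomial (Fin m) ℂ ⊗[ℂ] V)

variable {V} in
lemma lieDer_mk (Y : Vec m) (p : MvPolynomial (Fin m) ℂ) (v : V) :
    lieDer V Y (TensorField.mk p v) = TensorField.mk (Y p) v +
      ∑ i, ∑ j, TensorField.mk (pderiv j (Y (X i)) * p) ⁅(linElt j i : linAlg m), v⁆ := by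
  change (LinearMap.rTensor V (Y : MvPolynomial (Fin m) ℂ →ₗ[ℂ] MvPolynomial (Fin m) ℂ) +
    ∑ i, ∑ j, TensorProduct.map (LinearMap.mulLeft ℂ (pderiv j (Y (X i))))
      (LieModule.toEnd ℂ (linAlg m) V (linElt j i))) (p ⊗ₜ[ℂ] v) = _
  simp only [LinearMap.add_apply, LinearMap.sum_apply, TensorProduct.map_tmul,
    LinearMap.rTensor_tmul]
  rfl

lemma lieDer_add (Y Z : Vec m) : lieDer V (Y + Z) = lieDer V Y + lieDer V Z := by
  ext t
  induction t using TensorField.induction with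
  | h0 => simp
  | h2 s t hs ht => rw [map_add, map_add, hs, ht]
  | h1 p v =>
    simp only [LinearMap.add_apply, lieDer_mk, Derivation.add_apply, map_add, add_mul,
      TensorField.mk_add_left, Finset.sum_add_distrib]
    abel

lemma lieDer_smul (c : ℂ) (Y : Vec m) : lieDer V (c • Y) = c • lieDer V Y := by
  ext t
  induction t using TensorField.induction with
  | h0 => simp
  | h2 s t hs ht => rw [map_add, map_add, hs, ht]
  | h1 p v =>
    simp only [LinearMap.smul_apply, lieDer_mk, Derivation.smul_apply, Derivation.map_smul,
      smul_mul_assoc, TensorField.mk_smul_left, smul_add, Finset.smul_sum]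

/-- The chain rule `Z(p) = ∑ k, Z(x_k) ∂p/∂x_k`. -/
lemma apply_eq_sum (Z : Vec m) (p : MvPolynomial (Fin m) ℂ) :
    Z p = ∑ k, Z (X k) * pderiv k p := by
  have hs : ∀ q, (∑ k, Z (X k) • pderiv k : Vec m) q = ∑ k, Z (X k) * pderiv k q := by
    intro q
    rw [← Derivation.coeFnAddMonoidHom_apply, map_sum, Finset.sum_apply]
    rfl
  rw [← hs]
  congr 1
  apply derivation_ext
  intro i
  rw [hs]
  simp [pderiv_X, Pi.single_apply]

lemma pderiv_apply (Y : Vec m) (j : Fin m) (q : MvPolynomial (Fin m) ℂ) :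
    pderiv j (Y q) = Y (pderiv j q) + ∑ k, pderiv j (Y (X k)) * pderiv k q := by
  have h : ∀ k, pderiv j (pderiv k q) = pderiv k (pderiv j q) := by
    intro k
    have := congrArg (fun d : Vec m => d q) (lie_D_D j k)
    simpa [Derivation.commutator_apply, D, sub_eq_zero] using this
  rw [apply_eq_sum Y q, apply_eq_sum Y (pderiv j q), map_sum, ← Finset.sum_add_distrib]
  refine Finset.sum_congr rfl fun k _ => ?_
  rw [Derivation.leibniz, h]
  simp only [smul_eq_mul]
  ring

variable {V} in
lemma lieDer_lieDer_mk (Y Z : Vec m) (p : MvPolynomial (Fin m) ℂ) (v : V) :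
    lieDer V Y (lieDer V Z (TensorField.mk p v)) = TensorField.mk (Y (Z p)) v +
      ∑ i, ∑ j, TensorField.mk (pderiv j (Y (X i)) * Z p + pderiv j (Z (X i)) * Y p +
        Y (pderiv j (Z (X i))) * p) ⁅(linElt j i : linAlg m), v⁆ +
      ∑ i, ∑ j, ∑ k, ∑ l, TensorField.mk (pderiv l (Y (X k)) * pderiv j (Z (X i)) * p)
        ⁅(linElt l k : linAlg m), ⁅(linElt j i : linAlg m), v⁆⁆ := by
  have h : ∀ i j, Y (pderiv j (Z (X i)) * p) =
      pderiv j (Z (X i)) * Y p + Y (pderiv j (Z (X i))) * p := by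
    intro i j
    rw [Derivation.leibniz]
    simp only [smul_eq_mul]
    ring
  simp only [lieDer_mk, map_add, map_sum, h, TensorField.mk_add_left, Finset.sum_add_distrib,
    mul_assoc]
  abel

lemma sum_swap_pairs {G : Type*} [AddCommGroup G] (f : Fin m → Fin m → Fin m → Fin m → G) :
    ∑ i, ∑ j, ∑ k, ∑ l, f i j k l = ∑ i, ∑ j, ∑ k, ∑ l, f k l i j := by
  have e1 : ∀ g : Fin m → Fin m → Fin m → Fin m → G,
      ∑ i, ∑ j, ∑ k, ∑ l, g i j k l =
        ∑ x : Fin m × Fin m, ∑ y : Fin m × Fin m, g x.1 x.2 y.1 y.2 := by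
    intro g
    simp only [Fintype.sum_prod_type]
  rw [e1, e1, Finset.sum_comm]

variable {V} in
lemma mk_ite_lie (q : MvPolynomial (Fin m) ℂ) (c : Prop) [Decidable c] (x : linAlg m) (v : V) :
    TensorField.mk q ⁅(if c then x else 0), v⁆ = if c then TensorField.mk q ⁅x, v⁆ else 0 := by
  split_ifs
  · rfl
  · rw [zero_lie, TensorField.mk_zero_right]

variable {V} in
lemma quad_sum (a b : Fin m → Fin m → MvPolynomial (Fin m) ℂ) (p : MvPolynomial (Fin m) ℂ)
    (v : V) :
    (∑ i, ∑ j, ∑ k, ∑ l, TensorField.mk (a k l * b i j * p)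
        ⁅(linElt l k : linAlg m), ⁅(linElt j i : linAlg m), v⁆⁆) -
      (∑ i, ∑ j, ∑ k, ∑ l, TensorField.mk (b k l * a i j * p)
        ⁅(linElt l k : linAlg m), ⁅(linElt j i : linAlg m), v⁆⁆) =
      (∑ i, ∑ j, TensorField.mk ((∑ k, a k j * b i k) * p) ⁅(linElt j i : linAlg m), v⁆) -
      (∑ i, ∑ j, TensorField.mk ((∑ k, b k j * a i k) * p) ⁅(linElt j i : linAlg m), v⁆) := by
  have hsw := sum_swap_pairs fun i j k l => TensorField.mk (b k l * a i j * p)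
        ⁅(linElt l k : linAlg m), ⁅(linElt j i : linAlg m), v⁆⁆
  rw [hsw]
  have hb : ∀ i j k l : Fin m,
      TensorField.mk (a k l * b i j * p)
        ⁅(linElt l k : linAlg m), ⁅(linElt j i : linAlg m), v⁆⁆ -
      TensorField.mk (b i j * a k l * p)
        ⁅(linElt j i : linAlg m), ⁅(linElt l k : linAlg m), v⁆⁆ =
      (if j = k then TensorField.mk (a k l * b i j * p) ⁅(linElt l i : linAlg m), v⁆ else 0) -
      (if l = i then TensorField.mk (a k l * b i j * p) ⁅(linElt j k : linAlg m), v⁆ else 0) := by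
    intro i j k l
    rw [mul_comm (b i j) (a k l), ← TensorField.mk_sub_right, ← lie_lie, lie_linElt, sub_lie,
      TensorField.mk_sub_right, mk_ite_lie, mk_ite_lie]
  have hl : ∀ f g h h' : Fin m → Fin m → Fin m → Fin m → TensorField m V,
      (∀ i j k l, f i j k l - g i j k l = h i j k l - h' i j k l) →
      (∑ i, ∑ j, ∑ k, ∑ l, f i j k l) - (∑ i, ∑ j, ∑ k, ∑ l, g i j k l) =
      (∑ i, ∑ j, ∑ k, ∑ l, h i j k l) - (∑ i, ∑ j, ∑ k, ∑ l, h' i j k l) := by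
    intro f g h h' H
    simp only [← Finset.sum_sub_distrib, H]
  rw [hl _ _ _ _ hb]
  congr 1
  · refine Finset.sum_congr rfl fun i _ => ?_
    have h1 : ∀ j, (∑ k, ∑ l, if j = k then
        TensorField.mk (a k l * b i j * p) ⁅(linElt l i : linAlg m), v⁆ else 0) =
        ∑ l, TensorField.mk (a j l * b i j * p) ⁅(linElt l i : linAlg m), v⁆ := by
      intro j
      rw [Finset.sum_comm]
      refine Finset.sum_congr rfl fun l _ => ?_
      rw [Finset.sum_ite_eq]
      simp
    simp only [h1]
    rw [Finset.sum_comm]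
    refine Finset.sum_congr rfl fun l _ => ?_
    rw [Finset.sum_mul, TensorField.mk_sum_left]
  · simp only [Finset.sum_ite_eq', Finset.mem_univ, if_true]
    have h2 : ∀ k j, TensorField.mk ((∑ i, b i j * a k i) * p) ⁅(linElt j k : linAlg m), v⁆ =
        ∑ i, TensorField.mk (a k i * b i j * p) ⁅(linElt j k : linAlg m), v⁆ := by
      intro k j
      rw [Finset.sum_mul, TensorField.mk_sum_left]
      refine Finset.sum_congr rfl fun i _ => ?_
      rw [mul_comm (b i j)]
    simp only [h2]
    rw [Finset.sum_comm, Finset.sum_congr rfl fun j _ => Finset.sum_comm, Finset.sum_comm]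

lemma pderiv_lie_apply (Y Z : Vec m) (i j : Fin m) : pderiv j (⁅Y, Z⁆ (X i)) =
    Y (pderiv j (Z (X i))) - Z (pderiv j (Y (X i))) +
    ((∑ k, pderiv j (Y (X k)) * pderiv k (Z (X i))) -
    ∑ k, pderiv j (Z (X k)) * pderiv k (Y (X i))) := by
  rw [Derivation.commutator_apply, map_sub, pderiv_apply Y j (Z (X i)),
    pderiv_apply Z j (Y (X i))]
  ring

lemma lieDer_lie (Y Z : Vec m) : lieDer V ⁅Y, Z⁆ = ⁅lieDer V Y, lieDer V Z⁆ := by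
  ext t
  induction t using TensorField.induction with
  | h0 => simp
  | h2 s t hs ht => rw [map_add, map_add, hs, ht]
  | h1 p v =>
    have hq := quad_sum (fun i j => pderiv j (Y (X i))) (fun i j => pderiv j (Z (X i))) p v
    rw [Ring.lie_def, LinearMap.sub_apply, Module.End.mul_apply, Module.End.mul_apply,
      lieDer_lieDer_mk, lieDer_lieDer_mk, lieDer_mk, Derivation.commutator_apply,
      TensorField.mk_sub_left]
    simp only [pderiv_lie_apply, add_mul, sub_mul, TensorField.mk_add_left,
      TensorField.mk_sub_left, Finset.sum_add_distrib, Finset.sum_sub_distrib]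
    rw [← hq]
    abel

instance : LieRingModule (Vec m) (TensorField m V) where
  bracket Y t := lieDer V Y t
  add_lie Y Z t := by
    change lieDer V (Y + Z) t = lieDer V Y t + lieDer V Z t
    rw [lieDer_add, LinearMap.add_apply]
  lie_add Y s t := map_add (lieDer V Y) s t
  leibniz_lie Y Z t := by
    change lieDer V Y (lieDer V Z t) = lieDer V ⁅Y, Z⁆ t + lieDer V Z (lieDer V Y t)
    rw [lieDer_lie, Ring.lie_def]
    simp

instance : LieModule ℂ (Vec m) (TensorField m V) where
  smul_lie c Y t := by
    change lieDer V (c • Y) t = c • lieDer V Y t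
    rw [lieDer_smul, LinearMap.smul_apply]
  lie_smul c Y t := map_smul (lieDer V Y) c t

end Modules

section Cohomology

variable {L : Type*} [LieRing L] [LieAlgebra ℂ L]
variable (M : Type*) [AddCommGroup M] [Module ℂ M] [LieRingModule L M] [LieModule ℂ L M]

/-- The `k`-covariant 0-cochains of `L` with values in `M`: the `k`-invariants of `M`. -/
def relCochain0 (k : LieSubalgebra ℂ L) : Submodule ℂ M where
  carrier := {v | ∀ Y ∈ k, ⁅Y, v⁆ = 0}
  add_mem' {v w} hv hw Y hY := by rw [lie_add, hv Y hY, hw Y hY, add_zero]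
  zero_mem' Y _ := lie_zero Y
  smul_mem' c v hv Y hY := by rw [lie_smul, hv Y hY, smul_zero]

/-- The `h`-relative, `k`-covariant 1-cochains of `L` with values in `M`: the linear maps
`L → M` that vanish on `h` and commute with the action of `k`. For `h = k` these are the
usual `h`-relative 1-cochains. -/
def relCochain1 (h k : LieSubalgebra ℂ L) : Submodule ℂ (L →ₗ[ℂ] M) where
  carrier := {w | (∀ Y ∈ h, w Y = 0) ∧ ∀ Y ∈ k, ∀ Z, w ⁅Y, Z⁆ = ⁅Y, w Z⁆}
  add_mem' {v w} hv hw :=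
    ⟨fun Y hY => by simp [hv.1 Y hY, hw.1 Y hY],
      fun Y hY Z => by simp [hv.2 Y hY Z, hw.2 Y hY Z]⟩
  zero_mem' := ⟨fun _ _ => rfl, fun Y _ Z => by simp⟩
  smul_mem' c w hw :=
    ⟨fun Y hY => by simp [hw.1 Y hY], fun Y hY Z => by simp [hw.2 Y hY Z]⟩

/-- The coboundary of a 0-cochain: `(∂ v)(Y) = Y v`. -/
def d01 : M →ₗ[ℂ] (L →ₗ[ℂ] M) := (LieModule.toEnd ℂ L M : L →ₗ[ℂ] Module.End ℂ M).flip

/-- The `h`-relative, `k`-covariant 1-cocycles. -/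
def relCocycle1 (h k : LieSubalgebra ℂ L) : Submodule ℂ (L →ₗ[ℂ] M) :=
  relCochain1 M h k ⊓ LinearMap.ker (LieModule.Cohomology.d₁₂ ℂ L M)

/-- The coboundaries of the `k`-covariant 0-cochains. -/
def relCoboundary1 (k : LieSubalgebra ℂ L) : Submodule ℂ (L →ₗ[ℂ] M) :=
  (relCochain0 M k).map (d01 M)

/-- The `h`-relative, `k`-covariant 1-cohomology of `L` with values in `M` (for `h ≤ k`). -/
abbrev RelH1 (h k : LieSubalgebra ℂ L) : Type _ :=
  relCocycle1 M h k ⧸ (relCoboundary1 M k).submoduleOf (relCocycle1 M h k)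

end Cohomology

/-- The divergence `∑ i, ∂f_i/∂x_i` of a vector field `∑ i, f i * D i`. -/
def div (Y : Vec m) : MvPolynomial (Fin m) ℂ := ∑ i, pderiv i (Y (X i))

/-- The standard basis vector `e_1` of `ℂ^m`. -/
def eFirst (hm : 1 < m) : Fin m → ℂ := Pi.single ⟨0, by omega⟩ 1

/-- The standard basis vector `e_m` of `ℂ^m`. -/
def eLast (hm : 1 < m) : Fin m → ℂ := Pi.single ⟨m - 1, by omega⟩ 1

end VecCohomology

end

/-!
The coboundaries vanish, because a `b_m`-invariant tensor field is constant with `l_m`-invariant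
value and hence invariant under all fields (`relCoboundary1_affAlg`). So the theorem is about the
space of cocycles.

Let `c = ∑ i, lam i` be the scalar by which the Euler field acts on `V`. Let `w` be a cocycle
which vanishes on the fields of degree `d - 1`. By covariance under translations its values in
degree `d` are constant tensor fields `1 ⊗ v`. The Euler field acts on these by `c`, and on fields
of degree `d` by `d`, so they vanish unless `d = c` (`vanish_step`). Therefore `w` is determined by
its component of degree `c`, a homomorphism of `gl_m`-representations from the fields of degree
`c` to `V`, and `w = 0` unless `c` is a natural number.

* If `c ≥ 2`, then `w` vanishes in all degrees below `c`. As `m > 1`, the fields of degree `c` are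
  sums of brackets of fields of degree `1` and `c - 1` (`mD_mem_of_lie_mem`), and the cocycle
  identity gives `w = 0`.
* If `c = 0`, then the values of `w` on linear fields are invariants (`lie_apply_eq_zero`). They
  vanish unless `V` is trivial, in which case `w` is a multiple of the divergence.
* If `c = 1`, then `w` is determined by a homomorphism `Φ` from the quadratic fields. These are
  generated by the lowest weight vectors `x_m E` and `x_m^2 D_1`, of weights `e_m` and
  `2 e_m - e_1` (`IsQuadFamily.mem`). By uniqueness of the lowest weight vector of `V`
  (`IsLowest.unique`), `Φ` vanishes on `x_m E` unless `lam = e_m`, on `x_m^2 D_1` unless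
  `lam = 2 e_m - e_1`, and is otherwise unique up to a scalar. Vanishing on `x_m E` is what makes
  the cocycle `a_m`-relative in the last case.

Conversely every homomorphism `Ψ` from the quadratic fields to `V` gives the cocycle
`Y ↦ ∑ ∂_a ∂_b Y_k ⊗ Ψ (x_a x_b D_k)` (`quadCocycle_lie`). Since `V` is only known to be
irreducible of lowest weight `lam`, a nonzero `Ψ` has to be constructed: the subrepresentation of
`Vec m × V` generated by the pair of lowest weight vectors is the graph of a homomorphism, since
its part of that weight is a line (`IsLowest.exists_graph`, `IsQuadFamily.exists_transport`).
-/

noncomputable section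

namespace VecCohomology

open MvPolynomial

/-! ### Lowest weight representations of `gl_m` -/

section GlRep

variable {m : ℕ} {A : Type*} [AddCommGroup A] [Module ℂ A]

/-- A representation of `gl_m` on `A`, given by the operators `ρ j i` by which the linear
fields `x_j D_i` act; the axiom is the commutation relation `lie_xD_xD`. -/
def IsGlRep (ρ : Fin m → Fin m → Module.End ℂ A) : Prop :=
  ∀ j i l k x, ρ j i (ρ l k x) - ρ l k (ρ j i x) =
    (if l = i then ρ j k x else 0) - (if j = k then ρ l i x else 0)

/-- The subspace `K` is a subrepresentation. -/
def IsStable (ρ : Fin m → Fin m → Module.End ℂ A) (K : Submodule ℂ A) : Prop :=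
  ∀ j i, ∀ x ∈ K, ρ j i x ∈ K

/-- The vector `a`, possibly zero, has weight `lam` and is annihilated by the lowering operators
`ρ j i`, `i < j`. -/
structure IsLowest (ρ : Fin m → Fin m → Module.End ℂ A) (lam : Fin m → ℂ) (a : A) : Prop where
  weight : ∀ i, ρ i i a = lam i • a
  lower : ∀ i j, i < j → ρ j i a = 0

/-- The grading operator `∑ i, i • ρ i i`. The raising operators `ρ j i`, `j < i`, decrease its
eigenvalues by the positive integer `i - j`. -/
def height (ρ : Fin m → Fin m → Module.End ℂ A) : Module.End ℂ A :=
  ∑ i : Fin m, ((i : ℕ) : ℂ) • ρ i i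

/-- The `height`-eigenvalue of a vector of weight `lam`. -/
def heightOf (lam : Fin m → ℂ) : ℂ := ∑ i : Fin m, ((i : ℕ) : ℂ) * lam i

/-- The vectors obtained from `a` by applying finitely many raising operators. -/
inductive Raised (ρ : Fin m → Fin m → Module.End ℂ A) (a : A) : A → Prop
  | base : Raised ρ a a
  | step (j i : Fin m) (h : j < i) (x : A) (hx : Raised ρ a x) : Raised ρ a (ρ j i x)

variable {ρ : Fin m → Fin m → Module.End ℂ A} {lam mu : Fin m → ℂ} {a : A}

lemma height_apply (x : A) : height ρ x = ∑ i : Fin m, ((i : ℕ) : ℂ) • ρ i i x := by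
  simp [height, LinearMap.sum_apply]

lemma IsLowest.height_eq (ha : IsLowest ρ lam a) : height ρ a = heightOf lam • a := by
  rw [height_apply, heightOf, Finset.sum_smul]
  refine Finset.sum_congr rfl fun i _ => ?_
  rw [ha.weight, smul_smul]

lemma IsGlRep.height_comm (hρ : IsGlRep ρ) (j i : Fin m) (x : A) :
    height ρ (ρ j i x) = ρ j i (height ρ x) + (((j : ℕ) : ℂ) - ((i : ℕ) : ℂ)) • ρ j i x := by
  have h : ∀ l : Fin m, ((l : ℕ) : ℂ) • ρ l l (ρ j i x) = ((l : ℕ) : ℂ) • ρ j i (ρ l l x) +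
      ((if j = l then ((l : ℕ) : ℂ) • ρ l i x else 0) -
        (if l = i then ((l : ℕ) : ℂ) • ρ j l x else 0)) := by
    intro l
    rw [← sub_eq_iff_eq_add', ← smul_sub, hρ l l j i x, smul_sub, smul_ite, smul_ite, smul_zero]
  rw [height_apply, height_apply, Finset.sum_congr rfl fun l _ => h l, Finset.sum_add_distrib,
    Finset.sum_sub_distrib]
  simp [sub_smul]

/-- The subrepresentation generated by a lowest weight vector is spanned by the vectors obtained
by raising operators alone. -/
lemma IsLowest.isStable_span_raised (hρ : IsGlRep ρ) (ha : IsLowest ρ lam a) :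
    IsStable ρ (Submodule.span ℂ {x | Raised ρ a x}) := by
  have hup : ∀ j i, j < i → ∀ x ∈ Submodule.span ℂ {x | Raised ρ a x},
      ρ j i x ∈ Submodule.span ℂ {x | Raised ρ a x} := by
    intro j i hji x hx
    induction hx using Submodule.span_induction with
    | mem x hx => exact Submodule.subset_span (Raised.step j i hji x hx)
    | zero => simp
    | add x y _ _ h1 h2 => rw [map_add]; exact add_mem h1 h2
    | smul c x _ h => rw [map_smul]; exact Submodule.smul_mem _ c h
  have h0 : ∀ x, Raised ρ a x → ∀ l k, ρ l k x ∈ Submodule.span ℂ {x | Raised ρ a x} := by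
    intro x hx
    induction hx with
    | base =>
      intro l k
      have ha0 : a ∈ Submodule.span ℂ {x | Raised ρ a x} := Submodule.subset_span Raised.base
      rcases lt_trichotomy l k with h | h | h
      · exact hup l k h a ha0
      · rw [h, ha.weight]; exact Submodule.smul_mem _ _ ha0
      · rw [ha.lower k l h]; exact zero_mem _
    | step j i hji x hx ih =>
      intro l k
      rw [sub_eq_iff_eq_add'.1 (hρ l k j i x)]
      refine add_mem (hup j i hji _ (ih l k)) (sub_mem ?_ ?_)
      · split_ifs
        exacts [ih _ _, zero_mem _]
      · split_ifs
        exacts [ih _ _, zero_mem _]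
  intro j i x hx
  induction hx using Submodule.span_induction with
  | mem x hx => exact h0 x hx j i
  | zero => simp
  | add x y _ _ h1 h2 => rw [map_add]; exact add_mem h1 h2
  | smul c x _ h => rw [map_smul]; exact Submodule.smul_mem _ c h

/-- The raised vectors other than `a` itself have `height`-eigenvalue lower by a positive
integer. -/
lemma IsLowest.raised_mem (hρ : IsGlRep ρ) (ha : IsLowest ρ lam a) {x : A} (hx : Raised ρ a x) :
    x = a ∨ ∃ k : ℕ, x ∈ Module.End.eigenspace (height ρ) (heightOf lam - (k + 1 : ℕ)) := by
  have key : ∀ x, Raised ρ a x → ∀ k : ℕ, height ρ x = (heightOf lam - k) • x →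
      ∀ j i : Fin m, j < i → ∃ l : ℕ, ρ j i x ∈
        Module.End.eigenspace (height ρ) (heightOf lam - (l + 1 : ℕ)) := by
    intro x _ k hk j i hji
    obtain ⟨d, hd⟩ := Nat.exists_eq_add_of_lt (Fin.lt_def.1 hji)
    refine ⟨k + d, ?_⟩
    rw [Module.End.mem_eigenspace_iff, hρ.height_comm, hk, map_smul, ← add_smul, hd]
    congr 1
    push_cast
    ring
  induction hx with
  | base => exact Or.inl rfl
  | step j i hji x hx ih =>
    right
    rcases ih with rfl | ⟨k, hk⟩
    · exact key x Raised.base 0 (by simpa using ha.height_eq) j i hji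
    · exact key x hx (k + 1) (Module.End.mem_eigenspace_iff.1 hk) j i hji

lemma IsLowest.span_raised_le (hρ : IsGlRep ρ) (ha : IsLowest ρ lam a) :
    Submodule.span ℂ {x | Raised ρ a x} ≤ Submodule.span ℂ {a} ⊔
      ⨆ k : ℕ, Module.End.eigenspace (height ρ) (heightOf lam - (k + 1 : ℕ)) := by
  rw [Submodule.span_le]
  intro x hx
  rcases ha.raised_mem hρ hx with rfl | ⟨k, hk⟩
  · exact Submodule.mem_sup_left (Submodule.mem_span_singleton_self x)
  · exact Submodule.mem_sup_right (Submodule.mem_iSup_of_mem k hk)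

lemma disjoint_eigenspace {T : Module.End ℂ A} {ν : ℂ} {f : ℕ → ℂ} (h : ∀ k, f k ≠ ν) :
    Disjoint (Module.End.eigenspace T ν) (⨆ k, Module.End.eigenspace T (f k)) := by
  refine (Module.End.eigenspaces_iSupIndep T ν).mono_right (iSup_le fun k => ?_)
  exact le_iSup₂_of_le (f k) (h k) le_rfl

/-- The top `height`-eigenspace of the representation generated by a lowest weight vector is
the line of that vector. -/
lemma IsLowest.mem_span_of_height (hρ : IsGlRep ρ) (ha : IsLowest ρ lam a) {x : A}
    (hx : x ∈ Submodule.span ℂ {x | Raised ρ a x}) (hh : height ρ x = heightOf lam • x) :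
    x ∈ Submodule.span ℂ {a} := by
  obtain ⟨y, hy, z, hz, rfl⟩ := Submodule.mem_sup.1 (ha.span_raised_le hρ hx)
  have hy' : height ρ y = heightOf lam • y := by
    obtain ⟨t, rfl⟩ := Submodule.mem_span_singleton.1 hy
    rw [map_smul, ha.height_eq, smul_comm]
  have hz' : z ∈ Module.End.eigenspace (height ρ) (heightOf lam) := by
    rw [map_add, hy', smul_add, add_right_inj] at hh
    exact Module.End.mem_eigenspace_iff.2 hh
  have hd : ∀ k : ℕ, heightOf lam - (k + 1 : ℕ) ≠ heightOf lam := by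
    intro k hk
    rw [sub_eq_self] at hk
    exact Nat.succ_ne_zero k (by exact_mod_cast hk)
  rw [Submodule.disjoint_def.1 (disjoint_eigenspace hd) z hz' hz, add_zero]
  exact hy

lemma IsLowest.exists_height_eq (hρ : IsGlRep ρ) (ha : IsLowest ρ lam a) {x : A} (hx0 : x ≠ 0)
    (hx : x ∈ Submodule.span ℂ {x | Raised ρ a x}) {ν : ℂ} (hh : height ρ x = ν • x) :
    ∃ k : ℕ, ν = heightOf lam - k := by
  by_contra! hne
  have hle : Submodule.span ℂ {a} ⊔
      (⨆ k : ℕ, Module.End.eigenspace (height ρ) (heightOf lam - (k + 1 : ℕ))) ≤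
      ⨆ k : ℕ, Module.End.eigenspace (height ρ) (heightOf lam - k) := by
    refine sup_le ?_ (iSup_le fun k => le_iSup_of_le (k + 1) le_rfl)
    rw [Submodule.span_singleton_le_iff_mem]
    refine Submodule.mem_iSup_of_mem 0 (Module.End.mem_eigenspace_iff.2 ?_)
    simpa using ha.height_eq
  exact hx0 (Submodule.disjoint_def.1
    (disjoint_eigenspace (T := height ρ) (f := fun k : ℕ => heightOf lam - k)
      fun k => (hne k).symm) x
    (Module.End.mem_eigenspace_iff.2 hh) (hle (ha.span_raised_le hρ hx)))

/-- In a representation without proper subrepresentations the lowest weight vector is unique up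
to a scalar, and so is its weight. -/
lemma IsLowest.unique (hρ : IsGlRep ρ) (hirr : ∀ K, IsStable ρ K → K = ⊥ ∨ K = ⊤)
    (ha : IsLowest ρ lam a) (ha0 : a ≠ 0) {b : A} (hb : IsLowest ρ mu b) (hb0 : b ≠ 0) :
    mu = lam ∧ b ∈ Submodule.span ℂ {a} := by
  have htop : ∀ {c : A} {nu : Fin m → ℂ}, IsLowest ρ nu c → c ≠ 0 → ∀ x,
      x ∈ Submodule.span ℂ {x | Raised ρ c x} := by
    intro c nu hc hc0 x
    rcases hirr _ (hc.isStable_span_raised hρ) with h | h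
    · exact absurd ((Submodule.mem_bot ℂ).1 (h ▸ Submodule.subset_span Raised.base)) hc0
    · rw [h]; trivial
  obtain ⟨k, hk⟩ := ha.exists_height_eq hρ hb0 (htop ha ha0 b) hb.height_eq
  obtain ⟨l, hl⟩ := hb.exists_height_eq hρ ha0 (htop hb hb0 a) ha.height_eq
  have hkl : ((k + l : ℕ) : ℂ) = 0 := by
    rw [hk] at hl
    push_cast
    linear_combination hl
  have hk0 : k = 0 := by
    have := Nat.cast_eq_zero.1 hkl
    omega
  have hmem : b ∈ Submodule.span ℂ {a} := by
    refine ha.mem_span_of_height hρ (htop ha ha0 b) ?_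
    rw [hb.height_eq, hk, hk0]
    simp
  refine ⟨?_, hmem⟩
  obtain ⟨t, rfl⟩ := Submodule.mem_span_singleton.1 hmem
  funext i
  have h := hb.weight i
  rw [map_smul, ha.weight, smul_comm] at h
  exact (smul_left_injective ℂ hb0 h).symm

/-- Given vectors `a` and `v` of `A` and `V`, both lowest of the same weight, with `V`
irreducible, the subrepresentation of `A × V` generated by `(a, v)` is the graph of a
homomorphism to `V` from the subrepresentation of `A` generated by `a`: it meets `0 × V` in a
subrepresentation of `V` which does not contain `v`. -/
lemma IsLowest.exists_graph (hρ : IsGlRep ρ) (ha : IsLowest ρ lam a) (ha0 : a ≠ 0)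
    {V : Type*} [AddCommGroup V] [Module ℂ V] {σ : Fin m → Fin m → Module.End ℂ V}
    (hσ : IsGlRep σ) (hirr : ∀ K, IsStable σ K → K = ⊥ ∨ K = ⊤) {v : V}
    (hv : IsLowest σ lam v) (hv0 : v ≠ 0) :
    ∃ G : Submodule ℂ (A × V), (a, v) ∈ G ∧
      (∀ j i x y, (x, y) ∈ G → (ρ j i x, σ j i y) ∈ G) ∧ ∀ y, ((0 : A), y) ∈ G → y = 0 := by
  set τ : Fin m → Fin m → Module.End ℂ (A × V) := fun j i => (ρ j i).prodMap (σ j i) with hτ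
  have hτr : IsGlRep τ := by
    intro j i l k x
    refine Prod.ext ?_ ?_
    · simpa [hτ, apply_ite Prod.fst] using hρ j i l k x.1
    · simpa [hτ, apply_ite Prod.snd] using hσ j i l k x.2
  have hav : IsLowest τ lam (a, v) :=
    ⟨fun i => by simp [hτ, ha.weight, hv.weight], fun i j h => by simp [hτ, ha.lower i j h,
      hv.lower i j h]⟩
  set G := Submodule.span ℂ {x | Raised τ (a, v) x} with hG
  have hst : IsStable τ G := hav.isStable_span_raised hτr
  refine ⟨G, Submodule.subset_span Raised.base, fun j i x y h => hst j i _ h, ?_⟩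
  have hK : IsStable σ (G.comap (LinearMap.inr ℂ A V)) := by
    intro j i y hy
    have := hst j i _ hy
    simpa [hτ] using this
  rcases hirr _ hK with h | h
  · intro y hy
    have : y ∈ G.comap (LinearMap.inr ℂ A V) := hy
    rwa [h, Submodule.mem_bot] at this
  · exfalso
    have h0 : ((0 : A), v) ∈ G := by
      have : v ∈ G.comap (LinearMap.inr ℂ A V) := by rw [h]; trivial
      exact this
    have hh : height τ ((0 : A), v) = heightOf lam • ((0 : A), v) := by
      have : height τ ((0 : A), v) = ((0 : A), height σ v) := by
        simp [height_apply, hτ, Prod.ext_iff, Prod.fst_sum, Prod.snd_sum]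
      rw [this, hv.height_eq]
      simp
    obtain ⟨t, ht⟩ := Submodule.mem_span_singleton.1 (hav.mem_span_of_height hτr h0 hh)
    have h1 : t • a = 0 := congrArg Prod.fst ht
    have h2 : t • v = v := congrArg Prod.snd ht
    rw [(smul_eq_zero.1 h1).resolve_right ha0, zero_smul] at h2
    exact hv0 h2.symm

end GlRep

/-! ### Homomorphisms from the quadratic fields -/

section QuadFamily

variable {m : ℕ} {A : Type*} [AddCommGroup A] [Module ℂ A]

/-- The family `Φ a b k` is the image of the quadratic fields `x_a x_b D_k` under a homomorphism
of `gl_m`-representations into `A`. -/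
structure IsQuadFamily (ρ : Fin m → Fin m → Module.End ℂ A) (Φ : Fin m → Fin m → Fin m → A) :
    Prop where
  symm : ∀ a b k, Φ a b k = Φ b a k
  equiv : ∀ j i a b k, ρ j i (Φ a b k) = (if a = i then Φ j b k else 0) +
    (if b = i then Φ a j k else 0) - (if j = k then Φ a b i else 0)

variable {ρ : Fin m → Fin m → Module.End ℂ A} {Φ : Fin m → Fin m → Fin m → A}

/-- As a `gl_m`-representation, the quadratic fields are generated by `x_q^2 D_p` and `x_q E`,
for any distinct indices `p` and `q`. For `q` the last and `p` the first index these two are lowest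
weight vectors. -/
lemma IsQuadFamily.mem (hΦ : IsQuadFamily ρ Φ) {K : Submodule ℂ A} (hK : IsStable ρ K)
    {p q : Fin m} (hpq : p ≠ q) (h1 : Φ q q p ∈ K) (h2 : ∑ i, Φ q i i ∈ K) (a b k : Fin m) :
    Φ a b k ∈ K := by
  have two : ∀ x : A, x + x ∈ K → x ∈ K := by
    intro x hx
    have := K.smul_mem (2⁻¹ : ℂ) hx
    rwa [← two_smul ℂ x, inv_smul_smul₀ two_ne_zero] at this
  have swap : ∀ a i, a ≠ i → Φ a a i ∈ K → Φ i i a ∈ K := by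
    intro a i hai h
    -- the operator of `x_i D_a`, applied three times, takes `x_a^2 D_i` to
    -- `-6 x_i^2 D_a`
    have := hK i a _ (hK i a _ (hK i a _ h))
    simp only [hΦ.equiv, map_add, map_sub, hai.symm, if_true, if_false, add_zero,
      zero_add, sub_zero, zero_sub, hΦ.symm a i] at this
    have h6 := K.smul_mem (-(6⁻¹) : ℂ) this
    convert h6 using 1
    module
  have chD : ∀ a i k, a ≠ i → a ≠ k → Φ a a i ∈ K → Φ a a k ∈ K := by
    intro a i k hai hak h
    have := hK i k _ h
    simpa [hΦ.equiv, hak] using this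
  have polar : ∀ a b i, a ≠ i → b ≠ i → Φ a a i ∈ K → Φ a b i ∈ K := by
    intro a b i hai hbi h
    by_cases hab : a = b
    · rwa [← hab]
    · have := hK b a _ h
      simp only [hΦ.equiv, hbi, if_true, if_false, sub_zero] at this
      rw [hΦ.symm b a] at this
      exact two _ this
  have chX : ∀ a b i, a ≠ i → b ≠ i → Φ a a i ∈ K → Φ b b i ∈ K := by
    intro a b i hai hbi h
    by_cases hab : a = b
    · rwa [← hab]
    · have := hK b a _ (polar a b i hai hbi h)
      simpa [hΦ.equiv, hbi, Ne.symm hab] using this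
  have hoff : ∀ a i, a ≠ i → Φ a a i ∈ K := by
    intro a i hai
    have hp : ∀ a, a ≠ p → Φ a a p ∈ K := fun a ha => chX q a p hpq.symm ha h1
    by_cases hap : a = p
    · rw [hap]
      exact swap i p (hap ▸ hai.symm) (hp i (hap ▸ hai.symm))
    · exact chD a p i hap hai (hp a hap)
  have hcross : ∀ a i, a ≠ i → Φ i a i + Φ i a i - Φ a a a ∈ K := by
    intro a i hai
    have := hK i a _ (hoff a i hai)
    simpa [hΦ.equiv, hΦ.symm a i] using this
  have hq : Φ q q q ∈ K := by
    -- `2 x_i x_q D_i ≡ x_q^2 D_q` for `i ≠ q`, hence `2 x_q E ≡ (m + 1) x_q^2 D_q`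
    have hi : ∀ i, Φ q i i + Φ q i i - (Φ q q q + if i = q then Φ q q q else 0) ∈ K := by
      intro i
      by_cases hiq : i = q
      · simp [hiq]
      · simpa [hiq, hΦ.symm q i] using hcross q i (Ne.symm hiq)
    have hs := sub_mem (add_mem h2 h2) (sum_mem fun i (_ : i ∈ Finset.univ) => hi i)
    simp only [Finset.sum_sub_distrib, Finset.sum_add_distrib, Finset.sum_ite_eq',
      Finset.mem_univ, if_true, sub_sub_cancel, Finset.sum_const, Finset.card_univ,
      Fintype.card_fin] at hs
    have h3 : ((m : ℂ) + 1) • Φ q q q ∈ K := by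
      rwa [add_smul, one_smul, Nat.cast_smul_eq_nsmul]
    have h4 := K.smul_mem ((m : ℂ) + 1)⁻¹ h3
    rwa [inv_smul_smul₀ (Nat.cast_add_one_ne_zero m)] at h4
  have hdiag : ∀ a, Φ a a a ∈ K := by
    intro a
    by_cases haq : a = q
    · rwa [haq]
    · have h3 := hK a q _ hq
      simp only [hΦ.equiv, haq, if_true, if_false, sub_zero, hΦ.symm a q] at h3
      simpa using sub_mem h3 (hcross a q haq)
  by_cases hak : a = k
  · by_cases hbk : b = k
    · rw [hak, hbk]; exact hdiag k
    · rw [hak]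
      refine two _ ?_
      simpa using add_mem (hcross b k hbk) (hdiag b)
  · by_cases hbk : b = k
    · rw [hΦ.symm, hbk]
      refine two _ ?_
      simpa using add_mem (hcross a k hak) (hdiag a)
    · exact polar a b k hak hbk (hoff a k hak)

end QuadFamily

section QuadFamilyLowest

variable {m : ℕ} {A : Type*} [AddCommGroup A] [Module ℂ A]
  {ρ : Fin m → Fin m → Module.End ℂ A} {Φ Ψ : Fin m → Fin m → Fin m → A}

lemma IsQuadFamily.sub (hΦ : IsQuadFamily ρ Φ) (hΨ : IsQuadFamily ρ Ψ) :
    IsQuadFamily ρ fun a b k => Φ a b k - Ψ a b k := by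
  refine ⟨fun a b k => by rw [hΦ.symm, hΨ.symm], fun j i a b k => ?_⟩
  rw [map_sub, hΦ.equiv, hΨ.equiv]
  split_ifs <;> abel

lemma IsQuadFamily.smul (hΦ : IsQuadFamily ρ Φ) (c : ℂ) :
    IsQuadFamily ρ fun a b k => c • Φ a b k := by
  refine ⟨fun a b k => by rw [hΦ.symm], fun j i a b k => ?_⟩
  simp only [map_smul, hΦ.equiv, smul_sub, smul_add, smul_ite, smul_zero]

/-- The images of the fields `x_b E`. -/
lemma IsQuadFamily.equiv_trace (hΦ : IsQuadFamily ρ Φ) (j i b : Fin m) :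
    ρ j i (∑ k, Φ b k k) = if b = i then ∑ k, Φ j k k else 0 := by
  simp only [map_sum, hΦ.equiv, Finset.sum_sub_distrib, Finset.sum_add_distrib,
    Finset.sum_ite_eq', Finset.sum_ite_eq, Finset.mem_univ, if_true, add_sub_cancel_right]
  split_ifs <;> simp

/-- A homomorphism from the fields `x_b E`, given by `u b`, extends to all quadratic fields
through the divergence. -/
lemma isQuadFamily_trace {u : Fin m → A} (hu : ∀ j i b, ρ j i (u b) = if b = i then u j else 0) :
    IsQuadFamily ρ fun a b k => (if k = a then u b else 0) + (if k = b then u a else 0) := by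
  refine ⟨fun a b k => add_comm _ _, fun j i a b k => ?_⟩
  have hite : ∀ (P : Prop) [Decidable P] x, ρ j i (if P then x else 0) =
      if P then ρ j i x else 0 := by
    intro P _ x
    split_ifs
    exacts [rfl, map_zero _]
  rw [map_add, hite, hite, hu, hu]
  simp only [@eq_comm _ i a, @eq_comm _ i b, @eq_comm _ j k]
  split_ifs <;> abel

/-- The first index. -/
abbrev fstIdx (hm : 1 < m) : Fin m := ⟨0, by omega⟩

/-- The last index. -/
abbrev lstIdx (hm : 1 < m) : Fin m := ⟨m - 1, by omega⟩

variable (hm : 1 < m)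

lemma fstIdx_ne_lstIdx : fstIdx hm ≠ lstIdx hm := by
  intro h
  have := congrArg Fin.val h
  simp only at this
  omega

lemma eFirst_apply (i : Fin m) : eFirst hm i = if i = fstIdx hm then 1 else 0 :=
  Pi.single_apply _ _ _

lemma eLast_apply (i : Fin m) : eLast hm i = if i = lstIdx hm then 1 else 0 :=
  Pi.single_apply _ _ _

lemma IsQuadFamily.isLowest_corner (hΦ : IsQuadFamily ρ Φ) :
    IsLowest ρ (2 • eLast hm - eFirst hm) (Φ (lstIdx hm) (lstIdx hm) (fstIdx hm)) := by
  refine ⟨fun i => ?_, fun i j hij => ?_⟩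
  · rw [hΦ.equiv]
    simp only [eLast_apply, eFirst_apply, Pi.sub_apply, Pi.smul_apply]
    by_cases h1 : i = lstIdx hm
    · have h2 : i ≠ fstIdx hm := h1 ▸ (fstIdx_ne_lstIdx hm).symm
      simp only [h1, if_true, if_neg (fstIdx_ne_lstIdx hm).symm]
      module
    · by_cases h2 : i = fstIdx hm
      · simp only [h2, if_true, if_neg (fstIdx_ne_lstIdx hm), if_neg (fstIdx_ne_lstIdx hm).symm]
        module
      · simp only [if_neg h1, if_neg h2, if_neg (Ne.symm h1)]
        module
  · have h1 : lstIdx hm ≠ i := by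
      rintro rfl
      have := Fin.lt_def.1 hij
      have := j.2
      simp only at *
      omega
    have h2 : j ≠ fstIdx hm := by
      rintro rfl
      have := Fin.lt_def.1 hij
      simp at this
    rw [hΦ.equiv]
    simp [h1, h2]

lemma isLowest_last {u : Fin m → A} (hu : ∀ j i b, ρ j i (u b) = if b = i then u j else 0) :
    IsLowest ρ (eLast hm) (u (lstIdx hm)) := by
  refine ⟨fun i => ?_, fun i j hij => ?_⟩
  · rw [hu]
    simp only [eLast_apply]
    by_cases h1 : i = lstIdx hm
    · simp [h1]
    · simp only [if_neg h1, if_neg (Ne.symm h1), zero_smul]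
  · rw [hu, if_neg]
    rintro rfl
    have := Fin.lt_def.1 hij
    have := j.2
    simp only at *
    omega

variable {V : Type*} [AddCommGroup V] [Module ℂ V] {σ : Fin m → Fin m → Module.End ℂ V}
  {lam : Fin m → ℂ}

/-- If the two lowest weight vectors of a homomorphic image `Φ` of the quadratic fields are
multiples `s a` and `t a` of one vector `a`, lowest of weight `lam`, then `Φ` can be
transported to any irreducible representation of lowest weight `lam`. -/
lemma IsQuadFamily.exists_transport (hΦ : IsQuadFamily ρ Φ) (hρ : IsGlRep ρ) {a : A}
    (ha : IsLowest ρ lam a) (ha0 : a ≠ 0) (hσ : IsGlRep σ)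
    (hirr : ∀ K, IsStable σ K → K = ⊥ ∨ K = ⊤) {v : V} (hv : IsLowest σ lam v) (hv0 : v ≠ 0)
    {p q : Fin m} (hpq : p ≠ q) {s t : ℂ} (hs : Φ q q p = s • a) (ht : ∑ i, Φ q i i = t • a) :
    ∃ Ψ, IsQuadFamily σ Ψ ∧ Ψ q q p = s • v ∧ ∑ i, Ψ q i i = t • v := by
  obtain ⟨G, hav, hG, hG0⟩ := ha.exists_graph hρ ha0 hσ hirr hv hv0
  have huniq : ∀ {x y z}, (x, y) ∈ G → (x, z) ∈ G → y = z := by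
    intro x y z hy hz
    have := G.sub_mem hy hz
    rw [Prod.mk_sub_mk, sub_self] at this
    exact sub_eq_zero.1 (hG0 _ this)
  have hK : IsStable ρ (G.map (LinearMap.fst ℂ A V)) := by
    rintro j i _ ⟨⟨x, y⟩, hxy, rfl⟩
    exact ⟨_, hG j i x y hxy, rfl⟩
  have haK : a ∈ G.map (LinearMap.fst ℂ A V) := ⟨_, hav, rfl⟩
  have hmem := hΦ.mem hK hpq (hs ▸ Submodule.smul_mem _ s haK) (ht ▸ Submodule.smul_mem _ t haK)
  have hex : ∀ a b k, ∃ y, (Φ a b k, y) ∈ G := by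
    intro a b k
    obtain ⟨⟨x, y⟩, hxy, h⟩ := hmem a b k
    exact ⟨y, by rw [← h]; exact hxy⟩
  choose Ψ hΨ using hex
  have hite : ∀ (P : Prop) [Decidable P] {x y}, (x, y) ∈ G →
      ((if P then x else 0), (if P then y else 0)) ∈ G := by
    intro P _ x y h
    split_ifs
    exacts [h, zero_mem G]
  refine ⟨Ψ, ⟨fun a b k => huniq (hΨ a b k) (hΦ.symm a b k ▸ hΨ b a k), fun j i a b k => ?_⟩,
    ?_, ?_⟩
  · have h := hG j i _ _ (hΨ a b k)
    rw [hΦ.equiv] at h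
    exact huniq h (G.sub_mem (G.add_mem (hite _ (hΨ j b k)) (hite _ (hΨ a j k)))
      (hite _ (hΨ a b i)))
  · exact huniq (hΨ q q p) (hs ▸ G.smul_mem s hav)
  · have h := G.sum_mem fun i (_ : i ∈ Finset.univ) => hΨ q i i
    have h' : (∑ i, Φ q i i, ∑ i, Ψ q i i) ∈ G := by
      convert h
      · rw [Prod.fst_sum]
      · rw [Prod.snd_sum]
    exact huniq h' (ht ▸ G.smul_mem t hav)

end QuadFamilyLowest

/-! ### The adjoint representation on quadratic fields -/

section QuadFields

variable {m : ℕ}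

/-- The quadratic field `x_a x_b D_k`. -/
def qD (a b k : Fin m) : Vec m := (X a * X b : MvPolynomial (Fin m) ℂ) • pderiv k

lemma qD_X (a b k l : Fin m) : qD a b k (X l) = if l = k then X a * X b else 0 := by
  simp [qD, pderiv_X, Pi.single_apply]

lemma lie_xD_qD (j i a b k : Fin m) : ⁅xD j i, qD a b k⁆ =
    (if a = i then qD j b k else 0) + (if b = i then qD a j k else 0) -
      (if j = k then qD a b i else 0) := by
  apply derivation_ext
  intro l
  simp only [Derivation.commutator_apply, Derivation.sub_apply, Derivation.add_apply, qD_X, xD_X]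
  split_ifs <;> simp_all [xD_X, qD_X, mul_comm]

lemma sum_qD (b : Fin m) : ∑ i, qD b i i = xE b := by
  rw [xE, euler, Finset.smul_sum]
  refine Finset.sum_congr rfl fun i _ => ?_
  rw [xD, qD, mul_smul]

/-- The adjoint action of the linear fields on all fields. -/
def adAct (m : ℕ) (j i : Fin m) : Module.End ℂ (Vec m) := LieModule.toEnd ℂ (Vec m) (Vec m) (xD j i)

lemma lie_sub_of_lie_eq {L : Type*} [LieRing L] {P Q : Prop} [Decidable P] [Decidable Q]
    {x y z w : L} (h : ⁅x, y⁆ = (if P then z else 0) - (if Q then w else 0)) (u : L) :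
    ⁅x, ⁅y, u⁆⁆ - ⁅y, ⁅x, u⁆⁆ = (if P then ⁅z, u⁆ else 0) - (if Q then ⁅w, u⁆ else 0) := by
  rw [← lie_lie, h, sub_lie]
  split_ifs <;> simp

lemma isGlRep_adAct : IsGlRep (adAct m) := fun j i l k Y =>
  lie_sub_of_lie_eq (lie_xD_xD j i l k) Y

lemma isQuadFamily_qD : IsQuadFamily (adAct m) qD :=
  ⟨fun a b k => by rw [qD, qD, mul_comm], fun j i a b k => lie_xD_qD j i a b k⟩

lemma xE_ne_zero (b : Fin m) : xE b ≠ 0 := by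
  intro h
  have := congrArg (fun Y : Vec m => Y (X b)) h
  simp [xE_X] at this

lemma qD_ne_zero (a b k : Fin m) : qD a b k ≠ 0 := by
  intro h
  have := congrArg (fun Y : Vec m => Y (X k)) h
  simp [qD_X] at this

lemma isQuadFamily_trace_xE : IsQuadFamily (adAct m) fun a b k =>
    (if k = a then xE b else 0) + (if k = b then xE a else 0) :=
  isQuadFamily_trace fun j i b => lie_xD_xE j i b

lemma sum_trace_xE (b : Fin m) : ∑ i : Fin m, ((if i = b then xE i else 0) +
    (if i = i then xE b else 0)) = ((m : ℂ) + 1) • xE b := by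
  simp only [Finset.sum_add_distrib, Finset.sum_ite_eq', Finset.mem_univ, if_true,
    Finset.sum_const, Finset.card_univ, Fintype.card_fin, add_smul, one_smul,
    Nat.cast_smul_eq_nsmul]
  rw [add_comm]

end QuadFields

/-! ### The fibre as a representation of `gl_m` -/

section Fibre

variable {m : ℕ} (V : Type*) [AddCommGroup V] [Module ℂ V] [LieRingModule (linAlg m) V]
  [LieModule ℂ (linAlg m) V]

/-- The action of `x_j D_i` on the fibre. -/
def fibAct (j i : Fin m) : Module.End ℂ V := LieModule.toEnd ℂ (linAlg m) V (linElt j i)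

variable {V}

lemma fibAct_apply (j i : Fin m) (v : V) : fibAct V j i v = ⁅(linElt j i : linAlg m), v⁆ := rfl

lemma isGlRep_fibAct : IsGlRep (fibAct (m := m) V) := by
  intro j i l k v
  simp only [fibAct_apply]
  rw [← lie_lie, lie_linElt, sub_lie]
  split_ifs <;> simp

variable {lam : Fin m → ℂ}

lemma IsLowestWeightIrreducible.eq_bot_or_top (hV : IsLowestWeightIrreducible V lam)
    (K : Submodule ℂ V) (hK : IsStable (fibAct (m := m) V) K) : K = ⊥ ∨ K = ⊤ := by
  have hst : ∀ Y ∈ Submodule.span ℂ (linSet m), ∀ (hY : Y ∈ linAlg m), ∀ v ∈ K,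
      ⁅(⟨Y, hY⟩ : linAlg m), v⁆ ∈ K := by
    intro Y h
    induction h using Submodule.span_induction with
    | mem Y h =>
      obtain ⟨⟨j, i⟩, rfl⟩ := h
      intro hY v hv
      exact hK j i v hv
    | zero =>
      intro hY v hv
      have : (⟨0, hY⟩ : linAlg m) = 0 := rfl
      rw [this, zero_lie]
      exact zero_mem K
    | add Y Z h1 h2 ih1 ih2 =>
      intro hY v hv
      have : (⟨Y + Z, hY⟩ : linAlg m) = ⟨Y, h1⟩ + ⟨Z, h2⟩ := rfl
      rw [this, add_lie]
      exact add_mem (ih1 h1 v hv) (ih2 h2 v hv)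
    | smul c Y h1 ih =>
      intro hY v hv
      have : (⟨c • Y, hY⟩ : linAlg m) = c • ⟨Y, h1⟩ := rfl
      rw [this, smul_lie]
      exact K.smul_mem c (ih h1 v hv)
  let N : LieSubmodule ℂ (linAlg m) V :=
    { K with lie_mem := fun {x v} hv => hst x.1 x.2 x.2 v hv }
  have := hV.irreducible
  have hN : (N : Submodule ℂ V) = K := rfl
  rcases eq_bot_or_eq_top N with h | h
  · left; rw [← hN, h]; rfl
  · right; rw [← hN, h]; rfl

lemma IsLowestWeightIrreducible.exists_isLowest (hV : IsLowestWeightIrreducible V lam) :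
    ∃ v : V, v ≠ 0 ∧ IsLowest (fibAct V) lam v := by
  obtain ⟨v, hv, h1, h2⟩ := hV.exists_lowest
  exact ⟨v, hv, ⟨h1, h2⟩⟩

/-- The Euler field acts on the fibre by the scalar `∑ i, lam i`. -/
lemma IsLowestWeightIrreducible.euler_act (hV : IsLowestWeightIrreducible V lam) (w : V) :
    ∑ i : Fin m, fibAct V i i w = (∑ i, lam i) • w := by
  obtain ⟨v, hv0, hv⟩ := hV.exists_isLowest
  have hE : ∀ x, (∑ i, fibAct (m := m) V i i) x = ∑ i : Fin m, fibAct V i i x := fun x => by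
    rw [LinearMap.sum_apply]
  have hst : IsStable (fibAct (m := m) V)
      (Module.End.eigenspace (∑ i, fibAct (m := m) V i i) (∑ i : Fin m, lam i)) := by
    intro j i x hx
    rw [Module.End.mem_eigenspace_iff, hE] at hx ⊢
    rw [← map_smul, ← hx, map_sum, ← sub_eq_zero, ← Finset.sum_sub_distrib]
    simp [isGlRep_fibAct _ _ j i x]
  have hmem : v ∈ Module.End.eigenspace (∑ i, fibAct (m := m) V i i) (∑ i, lam i) := by
    rw [Module.End.mem_eigenspace_iff, hE, Finset.sum_smul]
    exact Finset.sum_congr rfl fun i _ => hv.weight i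
  rcases hV.eq_bot_or_top _ hst with h | h
  · rw [h] at hmem
    exact absurd ((Submodule.mem_bot ℂ).1 hmem) hv0
  · rw [← hE]
    exact Module.End.mem_eigenspace_iff.1 (h ▸ Submodule.mem_top)

/-- An irreducible representation of lowest weight zero is trivial. -/
lemma IsLowestWeightIrreducible.trivial_of_zero (hV : IsLowestWeightIrreducible V lam)
    (h0 : lam = 0) (j i : Fin m) (w : V) : fibAct V j i w = 0 := by
  subst h0
  obtain ⟨v, hv0, hv⟩ := hV.exists_isLowest
  have h1 : IsLowest (fun _ _ => 0 : Fin m → Fin m → Module.End ℂ ℂ) 0 1 :=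
    ⟨fun i => by simp, fun _ _ _ => rfl⟩
  obtain ⟨G, hav, hG, hG0⟩ := h1.exists_graph (fun _ _ _ _ _ => by simp) one_ne_zero
    isGlRep_fibAct hV.eq_bot_or_top hv hv0
  have hst : IsStable (fibAct (m := m) V) (⨅ j, ⨅ i, LinearMap.ker (fibAct (m := m) V j i)) := by
    intro j i x hx
    simp only [Submodule.mem_iInf, LinearMap.mem_ker] at hx ⊢
    simp [hx]
  have hmem : v ∈ ⨅ j, ⨅ i, LinearMap.ker (fibAct (m := m) V j i) := by
    simp only [Submodule.mem_iInf, LinearMap.mem_ker]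
    exact fun j i => hG0 _ (by simpa using hG j i _ _ hav)
  rcases hV.eq_bot_or_top _ hst with h | h
  · rw [h] at hmem
    exact absurd ((Submodule.mem_bot ℂ).1 hmem) hv0
  · have : w ∈ ⨅ j, ⨅ i, LinearMap.ker (fibAct (m := m) V j i) := h ▸ Submodule.mem_top
    simp only [Submodule.mem_iInf, LinearMap.mem_ker] at this
    exact this j i

lemma IsLowestWeightIrreducible.eq_zero_of_invariant (hV : IsLowestWeightIrreducible V lam)
    (h0 : lam ≠ 0) {w : V} (hw : ∀ j i, fibAct (m := m) V j i w = 0) : w = 0 := by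
  by_contra hw0
  obtain ⟨v, hv0, hv⟩ := hV.exists_isLowest
  have hlw : IsLowest (fibAct V) (0 : Fin m → ℂ) w := ⟨fun i => by simp [hw], fun i j _ => hw j i⟩
  exact h0 (hv.unique isGlRep_fibAct hV.eq_bot_or_top hv0 hlw hw0).1.symm

lemma IsLowestWeightIrreducible.mem_span_of_zero (hV : IsLowestWeightIrreducible V lam)
    (h0 : lam = 0) {v : V} (hv0 : v ≠ 0) (w : V) : w ∈ Submodule.span ℂ {v} := by
  have hst : IsStable (fibAct (m := m) V) (Submodule.span ℂ {v}) := by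
    intro j i x _
    rw [hV.trivial_of_zero h0]
    exact zero_mem _
  rcases hV.eq_bot_or_top _ hst with h | h
  · exact absurd ((Submodule.span_singleton_eq_bot).1 h) hv0
  · rw [h]; trivial

variable (hm : 1 < m)

lemma IsLowestWeightIrreducible.exists_quadFamily_last (hV : IsLowestWeightIrreducible V lam)
    (hlam : lam = eLast hm) {v : V} (hv : IsLowest (fibAct V) lam v) (hv0 : v ≠ 0) :
    ∃ Ψ, IsQuadFamily (fibAct (m := m) V) Ψ ∧
      Ψ (lstIdx hm) (lstIdx hm) (fstIdx hm) = 0 ∧ ∑ i, Ψ (lstIdx hm) i i = v := by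
  have ha : IsLowest (adAct m) (eLast hm) (xE (lstIdx hm)) :=
    isLowest_last hm fun j i b => lie_xD_xE j i b
  obtain ⟨Ψ, h1, h2, h3⟩ := (isQuadFamily_trace_xE.smul ((m : ℂ) + 1)⁻¹).exists_transport
    isGlRep_adAct (hlam ▸ ha)
    (xE_ne_zero _) isGlRep_fibAct hV.eq_bot_or_top hv hv0 (fstIdx_ne_lstIdx hm)
    (s := 0) (t := 1)
    (by rw [if_neg (fstIdx_ne_lstIdx hm)]; simp)
    (by rw [← Finset.smul_sum, sum_trace_xE, one_smul, inv_smul_smul₀ (Nat.cast_add_one_ne_zero m)])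
  exact ⟨Ψ, h1, by rw [h2, zero_smul], by rw [h3, one_smul]⟩

lemma IsLowestWeightIrreducible.exists_quadFamily_corner (hV : IsLowestWeightIrreducible V lam)
    (hlam : lam = 2 • eLast hm - eFirst hm) {v : V} (hv : IsLowest (fibAct V) lam v)
    (hv0 : v ≠ 0) :
    ∃ Ψ, IsQuadFamily (fibAct (m := m) V) Ψ ∧
      Ψ (lstIdx hm) (lstIdx hm) (fstIdx hm) = v ∧ ∑ i, Ψ (lstIdx hm) i i = 0 := by
  have ha := (isQuadFamily_qD (m := m)).isLowest_corner hm
  obtain ⟨Ψ, h1, h2, h3⟩ := (isQuadFamily_qD.sub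
    (isQuadFamily_trace_xE.smul ((m : ℂ) + 1)⁻¹)).exists_transport
    isGlRep_adAct (hlam ▸ ha)
    (qD_ne_zero _ _ _) isGlRep_fibAct hV.eq_bot_or_top hv hv0 (fstIdx_ne_lstIdx hm)
    (s := 1) (t := 0)
    (by rw [if_neg (fstIdx_ne_lstIdx hm)]; simp)
    (by rw [Finset.sum_sub_distrib, ← Finset.smul_sum, sum_trace_xE,
      inv_smul_smul₀ (Nat.cast_add_one_ne_zero m), sum_qD, sub_self, zero_smul])
  exact ⟨Ψ, h1, by rw [h2, one_smul], by rw [h3, zero_smul]⟩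

end Fibre

/-! ### Tensor fields and their invariants -/

section Sections

variable {m : ℕ} {V : Type*} [AddCommGroup V] [Module ℂ V]

/-- A tensor field as the family of its coefficients in `V`, indexed by the exponents of the
monomials. -/
def coefEquiv : TensorField m V ≃ₗ[ℂ] ((Fin m →₀ ℕ) →₀ V) :=
  TensorProduct.equivFinsuppOfBasisLeft (MvPolynomial.basisMonomials (Fin m) ℂ)

lemma coefEquiv_mk (p : MvPolynomial (Fin m) ℂ) (v : V) (J : Fin m →₀ ℕ) :
    coefEquiv (TensorField.mk p v) J = coeff J p • v :=
  TensorProduct.equivFinsuppOfBasisLeft_apply_tmul_apply _ p v J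

lemma mk_one_injective {v w : V} (h : TensorField.mk (m := m) 1 v = TensorField.mk 1 w) :
    v = w := by
  have := congrArg (fun t => coefEquiv t 0) h
  simpa [coefEquiv_mk] using this

lemma mk_one_eq_zero {v : V} : TensorField.mk (m := m) 1 v = 0 ↔ v = 0 := by
  refine ⟨fun h => mk_one_injective (m := m) ?_, fun h => ?_⟩
  · rw [h, TensorField.mk_zero_right]
  · rw [h, TensorField.mk_zero_right]

lemma mk_smul_right (c : ℂ) (p : MvPolynomial (Fin m) ℂ) (v : V) :
    TensorField.mk p (c • v) = c • TensorField.mk p v :=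
  TensorProduct.tmul_smul c p v

lemma mk_zero_left (v : V) : TensorField.mk (m := m) 0 v = 0 := TensorProduct.zero_tmul _ v

lemma mk_sum_right {ι : Type*} (s : Finset ι) (p : MvPolynomial (Fin m) ℂ) (v : ι → V) :
    TensorField.mk p (∑ i ∈ s, v i) = ∑ i ∈ s, TensorField.mk p (v i) :=
  TensorProduct.tmul_sum p s v

variable [LieRingModule (linAlg m) V] [LieModule ℂ (linAlg m) V]

lemma lie_mk (Y : Vec m) (p : MvPolynomial (Fin m) ℂ) (v : V) :
    ⁅Y, TensorField.mk p v⁆ = TensorField.mk (Y p) v +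
      ∑ i, ∑ j, TensorField.mk (pderiv j (Y (X i)) * p) (fibAct V j i v) :=
  lieDer_mk Y p v

lemma D_lie_mk (i : Fin m) (p : MvPolynomial (Fin m) ℂ) (v : V) :
    ⁅D i, TensorField.mk p v⁆ = TensorField.mk (pderiv i p) v := by
  rw [lie_mk]
  have : ∀ k j : Fin m, pderiv j (D i (X k)) = 0 := by
    intro k j
    rw [D_X]
    split_ifs <;> simp
  simp only [this, zero_mul, mk_zero_left, Finset.sum_const_zero, add_zero]
  rfl

lemma xD_lie_mk_one (j i : Fin m) (v : V) :
    ⁅xD j i, TensorField.mk (1 : MvPolynomial (Fin m) ℂ) v⁆ =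
      TensorField.mk 1 (fibAct V j i v) := by
  rw [lie_mk, Derivation.map_one_eq_zero, mk_zero_left, zero_add]
  have : ∀ l k : Fin m, TensorField.mk (pderiv k (xD j i (X l)) * 1) (fibAct V k l v) =
      if l = i then (if k = j then TensorField.mk 1 (fibAct V k l v) else 0) else 0 := by
    intro l k
    rw [xD_X]
    split_ifs with h1 h2
    · rw [h2, pderiv_X_self, mul_one]
    · rw [pderiv_X_of_ne (Ne.symm h2), zero_mul, mk_zero_left]
    · rw [map_zero, zero_mul, mk_zero_left]
  simp only [this]
  rw [Finset.sum_eq_single i]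
  · simp
  · intro l _ hl
    simp [hl]
  · simp

lemma lie_mk_of_invariant {v : V} (hv : ∀ j i, fibAct (m := m) V j i v = 0) (Y : Vec m)
    (p : MvPolynomial (Fin m) ℂ) : ⁅Y, TensorField.mk p v⁆ = TensorField.mk (Y p) v := by
  simp [lie_mk, hv, TensorField.mk_zero_right]

lemma coefEquiv_D_lie (i : Fin m) (t : TensorField m V) (J : Fin m →₀ ℕ) :
    coefEquiv ⁅D i, t⁆ J = ((J i : ℂ) + 1) • coefEquiv t (J + Finsupp.single i 1) := by
  induction t using TensorField.induction with
  | h0 => simp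
  | h2 s t hs ht => simp only [lie_add, map_add, Finsupp.add_apply, hs, ht, smul_add]
  | h1 p v =>
    rw [D_lie_mk, coefEquiv_mk, coefEquiv_mk, smul_smul, coeff_pderiv]
    rw [mul_comm]

/-- The tensor fields invariant under translations are the constant ones. -/
lemma exists_eq_mk_one {t : TensorField m V} (h : ∀ i : Fin m, ⁅D i, t⁆ = 0) :
    ∃ v, t = TensorField.mk 1 v := by
  refine ⟨coefEquiv t 0, coefEquiv.injective (Finsupp.ext fun J => ?_)⟩
  rw [coefEquiv_mk, coeff_one]
  split_ifs with hJ
  · rw [← hJ, one_smul]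
  · obtain ⟨i, hi⟩ := Finsupp.ne_iff.1 (Ne.symm hJ)
    have h1 := coefEquiv_D_lie i t (J - Finsupp.single i 1)
    rw [h i, tsub_add_cancel_of_le (Finsupp.single_le_iff.2 (Nat.one_le_iff_ne_zero.2 hi))] at h1
    rw [zero_smul]
    refine (smul_eq_zero.1 (h1.symm.trans (by simp))).resolve_left ?_
    exact Nat.cast_add_one_ne_zero _

lemma euler_lie_mk_one (v : V) :
    ⁅euler m, TensorField.mk (1 : MvPolynomial (Fin m) ℂ) v⁆ =
      TensorField.mk 1 (∑ i : Fin m, fibAct V i i v) := by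
  rw [euler, sum_lie, mk_sum_right]
  exact Finset.sum_congr rfl fun i _ => xD_lie_mk_one i i v

/-- The invariants of the affine algebra are invariant under all fields. -/
lemma lie_eq_zero_of_affine {t : TensorField m V} (hD : ∀ i : Fin m, ⁅D i, t⁆ = 0)
    (hx : ∀ j i : Fin m, ⁅xD j i, t⁆ = 0) (Y : Vec m) : ⁅Y, t⁆ = 0 := by
  obtain ⟨v, rfl⟩ := exists_eq_mk_one hD
  rw [lie_mk_of_invariant, Derivation.map_one_eq_zero, mk_zero_left]
  intro j i
  rw [← mk_one_eq_zero (m := m), ← xD_lie_mk_one, hx]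

end Sections

/-! ### Monomial fields -/

section Monomials

variable {m : ℕ}

/-- The monomial field `x^J D_k`. -/
def mD (J : Fin m →₀ ℕ) (k : Fin m) : Vec m :=
  (monomial J 1 : MvPolynomial (Fin m) ℂ) • pderiv k

lemma mD_X (J : Fin m →₀ ℕ) (k l : Fin m) : mD J k (X l) = if l = k then monomial J 1 else 0 := by
  simp [mD, pderiv_X, Pi.single_apply]

lemma mD_apply (J : Fin m →₀ ℕ) (k : Fin m) (p : MvPolynomial (Fin m) ℂ) :
    mD J k p = monomial J 1 * pderiv k p := rfl

lemma mD_monomial (J K : Fin m →₀ ℕ) (k : Fin m) :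
    mD J k (monomial K 1) = (K k : ℂ) • monomial (J + (K - Finsupp.single k 1)) 1 := by
  rw [mD_apply, pderiv_monomial, monomial_mul, smul_monomial]
  simp

/-- The truncated subtractions are harmless: where they truncate, the coefficient in front is
zero. -/
lemma lie_mD (J K : Fin m →₀ ℕ) (a b : Fin m) : ⁅mD J a, mD K b⁆ =
    (K a : ℂ) • mD (J + (K - Finsupp.single a 1)) b -
      (J b : ℂ) • mD (K + (J - Finsupp.single b 1)) a := by
  apply derivation_ext
  intro l
  simp only [Derivation.commutator_apply, Derivation.sub_apply, Derivation.smul_apply, mD_X]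
  split_ifs <;> simp [mD_monomial]

lemma mD_zero (k : Fin m) : mD 0 k = D k := by
  apply derivation_ext
  intro l
  rw [mD_X, D_X]
  simp

lemma mD_single (j k : Fin m) : mD (Finsupp.single j 1) k = xD j k := rfl

lemma mD_single_add (a b k : Fin m) :
    mD (Finsupp.single a 1 + Finsupp.single b 1) k = qD a b k := by
  rw [mD, qD, X, X, monomial_mul, one_mul]

lemma lie_D_mD (i : Fin m) (J : Fin m →₀ ℕ) (k : Fin m) :
    ⁅D i, mD J k⁆ = (J i : ℂ) • mD (J - Finsupp.single i 1) k := by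
  rw [← mD_zero, lie_mD]
  simp

lemma lie_euler_mD (J : Fin m →₀ ℕ) (k : Fin m) :
    ⁅euler m, mD J k⁆ = ((J.degree : ℂ) - 1) • mD J k := by
  have h : ∀ i, ⁅xD i i, mD J k⁆ = (J i : ℂ) • mD J k - if i = k then mD J k else 0 := by
    intro i
    rw [← mD_single, lie_mD]
    congr 1
    · by_cases h0 : J i = 0
      · simp [h0]
      · rw [add_tsub_cancel_of_le (Finsupp.single_le_iff.2 (Nat.one_le_iff_ne_zero.2 h0))]
    · by_cases hik : i = k
      · simp [hik]
      · simp [hik]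
  have hs : ⁅euler m, mD J k⁆ = ∑ i, ⁅xD i i, mD J k⁆ :=
    sum_lie (L := Vec m) (M := Vec m) Finset.univ (fun i => xD i i) (mD J k)
  rw [hs, Finset.sum_congr rfl fun i _ => h i, Finset.sum_sub_distrib,
    ← Finset.sum_smul, sub_smul (M := Vec m) (R := ℂ), Finsupp.degree_eq_sum]
  simp

lemma span_mD : Submodule.span ℂ (Set.range fun x : (Fin m →₀ ℕ) × Fin m => mD x.1 x.2) = ⊤ := by
  rw [eq_top_iff]
  intro Y _
  have hY : Y = ∑ k, Y (X k) • pderiv k := by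
    apply derivation_ext
    intro i
    rw [← Derivation.coeFnAddMonoidHom_apply (∑ k, _), map_sum, Finset.sum_apply]
    simp [pderiv_X, Pi.single_apply]
  rw [hY]
  refine sum_mem fun k _ => ?_
  rw [(Y (X k)).as_sum, Finset.sum_smul]
  refine sum_mem fun J _ => ?_
  have : (monomial J (coeff J (Y (X k))) : MvPolynomial (Fin m) ℂ) • (pderiv k : Vec m) =
      coeff J (Y (X k)) • mD J k := by
    rw [mD, ← smul_assoc, smul_monomial, smul_eq_mul, mul_one]
  rw [this]
  exact Submodule.smul_mem _ _ (Submodule.subset_span ⟨(J, k), rfl⟩)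

lemma eq_single_or_exists (J : Fin m →₀ ℕ) (k : Fin m) :
    J = Finsupp.single k (J k) ∨ ∃ a J', a ≠ k ∧ J = J' + Finsupp.single a 1 := by
  by_cases h : ∃ a, a ≠ k ∧ J a ≠ 0
  · obtain ⟨a, hak, ha⟩ := h
    exact Or.inr ⟨a, J - Finsupp.single a 1, hak, (tsub_add_cancel_of_le
      (Finsupp.single_le_iff.2 (Nat.one_le_iff_ne_zero.2 ha))).symm⟩
  · push Not at h
    left
    ext a
    by_cases hak : a = k
    · rw [hak, Finsupp.single_eq_same]
    · rw [h a hak, Finsupp.single_eq_of_ne hak]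

lemma exists_add_single {J : Fin m →₀ ℕ} {n : ℕ} (h : J.degree = n + 1) :
    ∃ a J', J = J' + Finsupp.single a 1 ∧ J'.degree = n := by
  have hJ : J ≠ 0 := by
    rintro rfl
    simp at h
  obtain ⟨a, ha⟩ := Finsupp.ne_iff.1 hJ
  have h1 : J = J - Finsupp.single a 1 + Finsupp.single a 1 :=
    (tsub_add_cancel_of_le (Finsupp.single_le_iff.2 (Nat.one_le_iff_ne_zero.2 ha))).symm
  refine ⟨a, _, h1, ?_⟩
  rw [h1, map_add, Finsupp.degree_single] at h
  omega

/-- For `m > 1` and `d ≥ 2`, the fields of degree `d` are sums of brackets of a quadratic field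
and a field of degree `d - 1`. -/
lemma mD_mem_of_lie_mem (hm : 1 < m) {d : ℕ} (hd : 2 ≤ d) {S : Submodule ℂ (Vec m)}
    (hS : ∀ P Q : Fin m →₀ ℕ, P.degree = 2 → Q.degree = d → ∀ a b, ⁅mD P a, mD Q b⁆ ∈ S)
    (J : Fin m →₀ ℕ) (hJ : J.degree = d + 1) (k : Fin m) : mD J k ∈ S := by
  have hsmul : ∀ (c : ℂ) (Y : Vec m), c ≠ 0 → c • Y ∈ S → Y ∈ S := fun c Y hc h =>
    (S.smul_mem_iff hc).1 h
  -- two factors `x_a x_b` with `a, b ≠ k`: the bracket of `x_a x_b D_a` with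
  -- `x^J' x_a D_k` is `(J' a + 1) x^J' x_a x_b D_k`
  have hoff : ∀ (k a b : Fin m) (J' : Fin m →₀ ℕ), a ≠ k → b ≠ k → J'.degree + 1 = d →
      mD (J' + Finsupp.single b 1 + Finsupp.single a 1) k ∈ S := by
    intro k a b J' ha hb hJ'
    have h := hS (Finsupp.single a 1 + Finsupp.single b 1) (J' + Finsupp.single a 1)
      (by simp) (by simpa using hJ') a k
    rw [lie_mD, add_tsub_cancel_right] at h
    refine hsmul ((J' a : ℂ) + 1) _ (Nat.cast_add_one_ne_zero _) ?_
    convert h using 1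
    rw [show J' + Finsupp.single b 1 + Finsupp.single a 1 =
      Finsupp.single a 1 + Finsupp.single b 1 + J' by abel]
    simp [ha, hb]
  rcases eq_single_or_exists J k with h0 | ⟨a, J1, ha, rfl⟩
  · have hJk : J k = d + 1 := by
      rw [h0, Finsupp.degree_single] at hJ
      exact hJ
    rw [h0, hJk]
    obtain ⟨i, hi⟩ : ∃ i : Fin m, i ≠ k := by
      have : Nontrivial (Fin m) := Fin.nontrivial_iff_two_le.2 hm
      exact exists_ne k
    obtain ⟨e, rfl⟩ := Nat.exists_eq_add_of_le' hd
    -- with `d = e + 2`, the bracket of `x_k^2 D_i` and `x_i x_k^(e+1) D_k` is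
    -- `x_k^(d+1) D_k - 2 x_i x_k^d D_i`, whose last term is covered by `hoff`
    have h1 := hS (Finsupp.single k 2) (Finsupp.single i 1 + Finsupp.single k (e + 1))
      (by simp) (by simp; omega) i k
    have h2 := hoff i k k (Finsupp.single i 1 + Finsupp.single k e) hi.symm hi.symm
      (by simp; omega)
    have h3 := S.add_mem h1 (S.smul_mem 2 h2)
    rw [lie_mD, add_tsub_cancel_left, ← Finsupp.single_tsub, ← Finsupp.single_add] at h3
    rw [show Finsupp.single i 1 + Finsupp.single k e + Finsupp.single k 1 + Finsupp.single k 1 =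
      Finsupp.single i 1 + Finsupp.single k (e + 1) + Finsupp.single k (2 - 1) by
        rw [Finsupp.single_add k e 1, ← add_assoc]] at h3
    rw [show e + 2 + 1 = 2 + (e + 1) by omega]
    simpa [hi] using h3
  · rcases eq_single_or_exists J1 k with h0 | ⟨b, J2, hb, rfl⟩
    · have hJk : J1 k = d := by
        rw [h0, map_add, Finsupp.degree_single, Finsupp.degree_single] at hJ
        omega
      rw [h0, hJk]
      -- the bracket of `x_k x_a D_k` and `x_k^d D_k` is `(d - 1) x_k^d x_a D_k`
      have h1 := hS (Finsupp.single k 1 + Finsupp.single a 1) (Finsupp.single k d)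
        (by simp) (by simp) k k
      rw [lie_mD, add_tsub_cancel_left] at h1
      have h2 : Finsupp.single k 1 + Finsupp.single a 1 +
          (Finsupp.single k d - Finsupp.single k 1) =
          Finsupp.single k d + Finsupp.single a 1 := by
        rw [← Finsupp.single_tsub, add_right_comm, ← Finsupp.single_add]
        congr 2
        omega
      rw [h2] at h1
      rw [← sub_smul (M := Vec m) (R := ℂ)] at h1
      refine hsmul _ _ ?_ h1
      simp only [Finsupp.add_apply, Finsupp.single_eq_same, Finsupp.single_eq_of_ne ha.symm]
      rw [sub_ne_zero]
      exact_mod_cast (by omega : d ≠ 1 + 0)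
    · refine hoff k a b J2 ha hb ?_
      simp only [map_add, Finsupp.degree_single] at hJ
      omega

end Monomials

/-! ### Linear maps vanishing on the subalgebras -/

section Subalgebras

variable {m : ℕ}

lemma D_mem_constAlg (i : Fin m) : D i ∈ constAlg m := Submodule.subset_span ⟨i, rfl⟩

lemma D_mem_affAlg (i : Fin m) : D i ∈ affAlg m := Submodule.subset_span (Or.inl ⟨i, rfl⟩)

lemma xD_mem_affAlg (j i : Fin m) : xD j i ∈ affAlg m :=
  Submodule.subset_span (Or.inr ⟨(j, i), rfl⟩)

variable {W : Type*} [AddCommGroup W] [Module ℂ W] {f : Vec m →ₗ[ℂ] W}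

lemma eq_zero_on_constAlg (hD : ∀ i, f (D i) = 0) {Y : Vec m} (hY : Y ∈ constAlg m) : f Y = 0 := by
  have h : Submodule.span ℂ (constSet m) ≤ LinearMap.ker f := by
    rw [Submodule.span_le]
    rintro _ ⟨i, rfl⟩
    exact hD i
  exact h hY

lemma eq_zero_on_affAlg (hD : ∀ i, f (D i) = 0) (hx : ∀ j i, f (xD j i) = 0) {Y : Vec m}
    (hY : Y ∈ affAlg m) : f Y = 0 := by
  have h : Submodule.span ℂ (constSet m ∪ linSet m) ≤ LinearMap.ker f := by
    rw [Submodule.span_le]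
    rintro _ (⟨i, rfl⟩ | ⟨⟨j, i⟩, rfl⟩)
    exacts [hD i, hx j i]
  exact h hY

lemma eq_zero_on_projAlg (hD : ∀ i, f (D i) = 0) (hx : ∀ j i, f (xD j i) = 0)
    (hE : ∀ j, f (xE j) = 0) {Y : Vec m} (hY : Y ∈ projAlg m) : f Y = 0 := by
  have h : Submodule.span ℂ (constSet m ∪ linSet m ∪ quadSet m) ≤ LinearMap.ker f := by
    rw [Submodule.span_le]
    rintro _ ((⟨i, rfl⟩ | ⟨⟨j, i⟩, rfl⟩) | ⟨j, rfl⟩)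
    exacts [hD i, hx j i, hE j]
  exact h hY

end Subalgebras

/-! ### Relative cocycles -/

section Cocycles

variable {L : Type*} [LieRing L] [LieAlgebra ℂ L]
  {M : Type*} [AddCommGroup M] [Module ℂ M] [LieRingModule L M] [LieModule ℂ L M]
  {h k : LieSubalgebra ℂ L} {w : L →ₗ[ℂ] M}

lemma mem_relCocycle1_iff : w ∈ relCocycle1 M h k ↔
    (∀ Y ∈ h, w Y = 0) ∧ (∀ Y ∈ k, ∀ Z, w ⁅Y, Z⁆ = ⁅Y, w Z⁆) ∧
      ∀ Y Z, w ⁅Y, Z⁆ = ⁅Y, w Z⁆ - ⁅Z, w Y⁆ := by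
  have : w ∈ LinearMap.ker (LieModule.Cohomology.d₁₂ ℂ L M) ↔
      ∀ Y Z, w ⁅Y, Z⁆ = ⁅Y, w Z⁆ - ⁅Z, w Y⁆ := by
    rw [LinearMap.mem_ker]
    constructor
    · intro h Y Z
      have h1 := LieModule.Cohomology.d₁₂_apply_apply ℂ L M w Y Z
      rw [h] at h1
      exact (sub_eq_zero.1 h1.symm).symm
    · intro h
      refine Subtype.ext (LinearMap.ext fun Y => LinearMap.ext fun Z => ?_)
      change ⁅Y, w Z⁆ - ⁅Z, w Y⁆ - w ⁅Y, Z⁆ = 0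
      rw [h, sub_self]
  rw [relCocycle1, Submodule.mem_inf, this, ← and_assoc]
  rfl

/-- A cocycle which vanishes on `k` is automatically `k`-covariant. -/
lemma mem_relCocycle1_of_vanish (hk : ∀ Y ∈ k, w Y = 0)
    (hw : ∀ Y Z, w ⁅Y, Z⁆ = ⁅Y, w Z⁆ - ⁅Z, w Y⁆) : w ∈ relCocycle1 M k k := by
  refine mem_relCocycle1_iff.2 ⟨hk, fun Y hY Z => ?_, hw⟩
  rw [hw, hk Y hY, lie_zero, sub_zero]

/-- The values on `k` of a `k`-covariant cocycle are invariants of the whole Lie algebra. -/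
lemma lie_apply_eq_zero (hw : w ∈ relCocycle1 M h k) {Y : L} (hY : Y ∈ k) (Z : L) :
    ⁅Z, w Y⁆ = 0 := by
  obtain ⟨_, h2, h3⟩ := mem_relCocycle1_iff.1 hw
  have h4 := h3 Y Z
  rw [h2 Y hY] at h4
  exact sub_eq_self.1 h4.symm

lemma relH1_span_eq_top {w : relCocycle1 M h k} (hw : ∀ w', ∃ c : ℂ, w' = c • w) :
    Submodule.span ℂ {(Submodule.Quotient.mk w : RelH1 M h k)} = ⊤ := by
  rw [eq_top_iff]
  rintro x -
  obtain ⟨w', rfl⟩ := Submodule.Quotient.mk_surjective _ x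
  obtain ⟨c, rfl⟩ := hw w'
  exact Submodule.mem_span_singleton.2 ⟨c, rfl⟩

lemma rank_relH1_eq_zero (hw : ∀ w ∈ relCocycle1 M h k, w = 0) :
    Module.rank ℂ (RelH1 M h k) = 0 := by
  have : Subsingleton (RelH1 M h k) := by
    refine subsingleton_of_forall_eq 0 fun x => ?_
    obtain ⟨w, rfl⟩ := Submodule.Quotient.mk_surjective _ x
    rw [show w = 0 from Subtype.ext (hw w.1 w.2)]
    rfl
  exact rank_subsingleton' ℂ _

lemma rank_relH1_eq_one (hcob : relCoboundary1 M k = ⊥) {w : relCocycle1 M h k} (hw0 : w ≠ 0)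
    (hw : ∀ w', ∃ c : ℂ, w' = c • w) :
    Module.rank ℂ (RelH1 M h k) = 1 := by
  refine rank_eq_one (Submodule.Quotient.mk w) ?_ ?_
  · intro h0
    rw [Submodule.Quotient.mk_eq_zero, hcob, Submodule.submoduleOf, Submodule.mem_comap] at h0
    exact hw0 (Subtype.ext h0)
  · intro x
    obtain ⟨w', rfl⟩ := Submodule.Quotient.mk_surjective _ x
    obtain ⟨c, rfl⟩ := hw w'
    exact ⟨c, rfl⟩

end Cocycles

/-! ### Cocycles by degree -/

section Restrictions

variable {m : ℕ} {V : Type*} [AddCommGroup V] [Module ℂ V] [LieRingModule (linAlg m) V]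
  [LieModule ℂ (linAlg m) V]

lemma relCoboundary1_affAlg : relCoboundary1 (TensorField m V) (affAlg m) = ⊥ := by
  rw [eq_bot_iff]
  rintro _ ⟨t, ht, rfl⟩
  rw [Submodule.mem_bot]
  refine LinearMap.ext fun Y => ?_
  change ⁅Y, t⁆ = 0
  exact lie_eq_zero_of_affine (fun i => ht _ (D_mem_affAlg i))
    (fun j i => ht _ (xD_mem_affAlg j i)) Y

lemma eq_zero_of_mD {W : Type*} [AddCommGroup W] [Module ℂ W] {f : Vec m →ₗ[ℂ] W}
    (hf : ∀ J k, f (mD J k) = 0) : f = 0 := by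
  have : Submodule.span ℂ (Set.range fun x : (Fin m →₀ ℕ) × Fin m => mD x.1 x.2) ≤
      LinearMap.ker f := by
    rw [Submodule.span_le]
    rintro _ ⟨x, rfl⟩
    exact hf x.1 x.2
  rw [span_mD, top_le_iff] at this
  exact LinearMap.ker_eq_top.1 this

variable {w : Vec m →ₗ[ℂ] TensorField m V}
  (hw : w ∈ relCocycle1 (TensorField m V) (constAlg m) (affAlg m))
include hw

lemma apply_D (i : Fin m) : w (D i) = 0 :=
  (mem_relCocycle1_iff.1 hw).1 _ (D_mem_constAlg i)

lemma apply_lie_D (i : Fin m) (Z : Vec m) : w ⁅D i, Z⁆ = ⁅D i, w Z⁆ :=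
  (mem_relCocycle1_iff.1 hw).2.1 _ (D_mem_affAlg i) Z

lemma apply_lie_xD (j i : Fin m) (Z : Vec m) : w ⁅xD j i, Z⁆ = ⁅xD j i, w Z⁆ :=
  (mem_relCocycle1_iff.1 hw).2.1 _ (xD_mem_affAlg j i) Z

lemma apply_lie_euler (Z : Vec m) : w ⁅euler m, Z⁆ = ⁅euler m, w Z⁆ :=
  (mem_relCocycle1_iff.1 hw).2.1 _ (sum_mem fun i _ => xD_mem_affAlg i i) Z

/-- Where the cocycle vanishes one degree below, its values are constant tensor fields. -/
lemma exists_const {n : ℕ} (h : ∀ J k, J.degree = n → w (mD J k) = 0) {J : Fin m →₀ ℕ}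
    (hJ : J.degree = n + 1) (k : Fin m) : ∃ v, w (mD J k) = TensorField.mk 1 v := by
  refine exists_eq_mk_one fun i => ?_
  rw [← apply_lie_D hw, lie_D_mD, map_smul]
  by_cases h0 : J i = 0
  · simp [h0]
  · rw [h, smul_zero]
    have h1 : J = J - Finsupp.single i 1 + Finsupp.single i 1 :=
      (tsub_add_cancel_of_le (Finsupp.single_le_iff.2 (Nat.one_le_iff_ne_zero.2 h0))).symm
    rw [h1, map_add, Finsupp.degree_single] at hJ
    omega

/-- The Euler field acts on constant tensor fields by `c`, hence the lowest degree in which the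
cocycle does not vanish can only be `c`. -/
lemma vanish_step {c : ℂ} (hc : ∀ v : V, ∑ i : Fin m, fibAct V i i v = c • v) {n : ℕ}
    (hn : (n : ℂ) ≠ c) (h : ∀ J k, J.degree = n → w (mD J k) = 0) {J : Fin m →₀ ℕ}
    (hJ : J.degree = n + 1) (k : Fin m) : w (mD J k) = 0 := by
  obtain ⟨v, hv⟩ := exists_const hw h hJ k
  have h1 := apply_lie_euler hw (mD J k)
  rw [lie_euler_mD, map_smul, hv, euler_lie_mk_one, hc, mk_smul_right, hJ, ← sub_eq_zero,
    ← sub_smul] at h1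
  rw [hv]
  refine (smul_eq_zero.1 h1).resolve_left ?_
  push_cast
  rw [add_sub_cancel_right]
  exact sub_ne_zero.2 hn

lemma vanish_degree_zero {J : Fin m →₀ ℕ} (hJ : J.degree = 0) (k : Fin m) : w (mD J k) = 0 := by
  rw [(Finsupp.degree_eq_zero_iff J).1 hJ, mD_zero, apply_D hw]

lemma vanish_below {c : ℂ} (hc : ∀ v : V, ∑ i : Fin m, fibAct V i i v = c • v) {d : ℕ}
    (hd : (d : ℂ) = c) {n : ℕ} (hn : n ≤ d) {J : Fin m →₀ ℕ} (hJ : J.degree = n) (k : Fin m) :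
    w (mD J k) = 0 := by
  induction n generalizing J k with
  | zero => exact vanish_degree_zero hw hJ k
  | succ n ih =>
    refine vanish_step hw hc (n := n) ?_ (fun J k hJ => ih (by omega) hJ k) hJ k
    rw [← hd]
    exact_mod_cast (by omega : n ≠ d)

/-- A cocycle is determined by its component of degree `c`. -/
lemma eq_zero_of_vanish {c : ℂ} (hc : ∀ v : V, ∑ i : Fin m, fibAct V i i v = c • v)
    (h : ∀ d : ℕ, (d : ℂ) = c → ∀ J k, J.degree = d + 1 → w (mD J k) = 0) : w = 0 := by
  have key : ∀ n : ℕ, ∀ J k, J.degree = n → w (mD J k) = 0 := by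
    intro n
    induction n with
    | zero => exact fun J k hJ => vanish_degree_zero hw hJ k
    | succ n ih =>
      intro J k hJ
      by_cases hn : (n : ℂ) = c
      · exact h n hn J k hJ
      · exact vanish_step hw hc hn ih hJ k
  exact eq_zero_of_mD fun J k => key _ J k rfl

lemma eq_zero_of_two_le (hm : 1 < m) {c : ℂ}
    (hc : ∀ v : V, ∑ i : Fin m, fibAct V i i v = c • v) {d : ℕ} (hd2 : 2 ≤ d)
    (hd : (d : ℂ) = c) : w = 0 := by
  refine eq_zero_of_vanish hw hc fun e he J k hJ => ?_
  obtain rfl : e = d := by exact_mod_cast he.trans hd.symm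
  refine mD_mem_of_lie_mem hm hd2 (S := LinearMap.ker w) (fun P Q hP hQ a b => ?_) J hJ k
  rw [LinearMap.mem_ker, (mem_relCocycle1_iff.1 hw).2.2,
    vanish_below hw hc hd le_rfl hQ, vanish_below hw hc hd hd2 hP, lie_zero, lie_zero, sub_zero]

lemma eq_zero_of_linear {c : ℂ} (hc : ∀ v : V, ∑ i : Fin m, fibAct V i i v = c • v)
    (hc0 : c = 0) (h : ∀ j i, w (xD j i) = 0) : w = 0 := by
  refine eq_zero_of_vanish hw hc fun e he J k hJ => ?_
  obtain rfl : e = 0 := by exact_mod_cast he.trans hc0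
  obtain ⟨a, J', rfl, hJ'⟩ := exists_add_single hJ
  rw [(Finsupp.degree_eq_zero_iff J').1 hJ', zero_add, mD_single]
  exact h a k

lemma apply_xD_eq_zero {c : ℂ} (hc : ∀ v : V, ∑ i : Fin m, fibAct V i i v = c • v)
    (hc1 : c = 1) (j i : Fin m) : w (xD j i) = 0 := by
  rw [← mD_single]
  exact vanish_below hw hc (d := 1) (by rw [hc1, Nat.cast_one]) le_rfl (by simp) i

lemma eq_zero_of_quadratic {c : ℂ} (hc : ∀ v : V, ∑ i : Fin m, fibAct V i i v = c • v)
    (hc1 : c = 1) (h : ∀ a b k, w (qD a b k) = 0) : w = 0 := by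
  refine eq_zero_of_vanish hw hc fun e he J k hJ => ?_
  obtain rfl : e = 1 := by exact_mod_cast he.trans hc1
  obtain ⟨a, J', rfl, hJ'⟩ := exists_add_single hJ
  obtain ⟨b, J'', rfl, hJ''⟩ := exists_add_single (n := 0) hJ'
  rw [(Finsupp.degree_eq_zero_iff J'').1 hJ'', zero_add, mD_single_add]
  exact h b a k

/-- For `c = 1` the restriction of a cocycle to the quadratic fields is a `gl_m`-homomorphism
to the fibre. -/
lemma exists_quadFamily {c : ℂ} (hc : ∀ v : V, ∑ i : Fin m, fibAct V i i v = c • v)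
    (hc1 : c = 1) : ∃ Φ : Fin m → Fin m → Fin m → V, IsQuadFamily (fibAct V) Φ ∧
      ∀ a b k, w (qD a b k) = TensorField.mk 1 (Φ a b k) := by
  have hex : ∀ a b k, ∃ v, w (qD a b k) = TensorField.mk 1 v := by
    intro a b k
    rw [← mD_single_add]
    exact exists_const hw (n := 1) (fun J k hJ => vanish_below hw hc (d := 1)
      (by rw [hc1, Nat.cast_one]) le_rfl hJ k) (by simp) k
  choose Φ hΦ using hex
  refine ⟨Φ, ⟨fun a b k => mk_one_injective (m := m) ?_, fun j i a b k => ?_⟩, hΦ⟩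
  · rw [← hΦ, ← hΦ, isQuadFamily_qD.symm]
  · apply mk_one_injective (m := m)
    rw [← xD_lie_mk_one, ← hΦ, ← apply_lie_xD hw, lie_xD_qD, map_sub, map_add,
      TensorField.mk_sub_right, TensorField.mk_add_right]
    simp only [apply_ite w, apply_ite (TensorField.mk (m := m) (V := V) 1), map_zero, hΦ,
      TensorField.mk_zero_right]

lemma exists_invariant (j i : Fin m) : ∃ v : V, w (xD j i) = TensorField.mk 1 v ∧
    ∀ l k, fibAct (m := m) V l k v = 0 := by
  obtain ⟨v, hv⟩ := exists_const hw (n := 0) (fun J k hJ => vanish_degree_zero hw hJ k)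
    (J := Finsupp.single j 1) (by simp) i
  rw [mD_single] at hv
  refine ⟨v, hv, fun l k => ?_⟩
  rw [← mk_one_eq_zero (m := m), ← xD_lie_mk_one, ← hv]
  exact lie_apply_eq_zero hw (xD_mem_affAlg j i) _

/-- On the linear fields a cocycle is a multiple of the trace. -/
lemma apply_xD_eq_trace (j i l : Fin m) : w (xD j i) = if j = i then w (xD l l) else 0 := by
  have h0 : ∀ a b c d : Fin m, w ⁅xD a b, xD c d⁆ = 0 := by
    intro a b c d
    rw [apply_lie_xD hw]
    exact lie_apply_eq_zero hw (xD_mem_affAlg c d) _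
  by_cases hji : j = i
  · subst hji
    rw [if_pos rfl]
    have h1 := h0 j l l j
    rwa [lie_xD_xD, if_pos rfl, if_pos rfl, map_sub, sub_eq_zero] at h1
  · rw [if_neg hji]
    have h1 := h0 j j j i
    rwa [lie_xD_xD, if_pos rfl, if_neg hji, sub_zero] at h1

end Restrictions

/-! ### The quadratic and divergence cocycles -/

section Explicit

variable {m : ℕ} {V : Type*} [AddCommGroup V] [Module ℂ V]

/-- The cochain `Y ↦ ∑ ∂_a ∂_b Y_k ⊗ Ψ a b k`. For the family `Ψ` of all quadratic fields it is
the Lie derivative of the flat connection. -/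
def quadCocycle (Ψ : Fin m → Fin m → Fin m → V) : Vec m →ₗ[ℂ] TensorField m V where
  toFun Y := ∑ a, ∑ b, ∑ k, TensorField.mk (pderiv a (pderiv b (Y (X k)))) (Ψ a b k)
  map_add' Y Z := by
    simp only [Derivation.add_apply, map_add, TensorField.mk_add_left, Finset.sum_add_distrib]
  map_smul' c Y := by
    simp only [Derivation.smul_apply, Derivation.map_smul, TensorField.mk_smul_left,
      Finset.smul_sum, RingHom.id_apply]

lemma quadCocycle_apply (Ψ : Fin m → Fin m → Fin m → V) (Y : Vec m) :
    quadCocycle Ψ Y = ∑ a, ∑ b, ∑ k, TensorField.mk (pderiv a (pderiv b (Y (X k)))) (Ψ a b k) :=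
  rfl

lemma quadCocycle_D (Ψ : Fin m → Fin m → Fin m → V) (i : Fin m) : quadCocycle Ψ (D i) = 0 := by
  have : ∀ b k : Fin m, pderiv b (D i (X k)) = 0 := by
    intro b k
    rw [D_X]
    split_ifs <;> simp
  simp only [quadCocycle_apply, this, map_zero, mk_zero_left, Finset.sum_const_zero]

lemma quadCocycle_xD (Ψ : Fin m → Fin m → Fin m → V) (j i : Fin m) :
    quadCocycle Ψ (xD j i) = 0 := by
  have : ∀ a b k : Fin m, pderiv a (pderiv b (xD j i (X k))) = 0 := by
    intro a b k
    rw [xD_X]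
    split_ifs
    · rw [pderiv_X, Pi.single_apply]
      split_ifs <;> simp
    · simp
  simp only [quadCocycle_apply, this, mk_zero_left, Finset.sum_const_zero]

lemma pderiv_pderiv_X_mul_X (a b c d : Fin m) :
    pderiv c (pderiv d (X a * X b : MvPolynomial (Fin m) ℂ)) =
      (if c = b then if d = a then 1 else 0 else 0) +
        if c = a then if d = b then 1 else 0 else 0 := by
  have h : ∀ a d : Fin m, pderiv d (X a : MvPolynomial (Fin m) ℂ) = if d = a then 1 else 0 := by
    intro a d
    rw [pderiv_X, Pi.single_apply]
    simp only [eq_comm]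
  rw [Derivation.leibniz, h, h, map_add]
  simp only [smul_eq_mul, mul_ite, mul_one, mul_zero, apply_ite (pderiv c), map_zero, h]
  split_ifs <;> simp

lemma quadCocycle_qD {Ψ : Fin m → Fin m → Fin m → V} (hΨ : ∀ a b k, Ψ a b k = Ψ b a k)
    (a b k : Fin m) : quadCocycle Ψ (qD a b k) = (2 : ℂ) • TensorField.mk 1 (Ψ a b k) := by
  have h : ∀ c d l : Fin m, TensorField.mk (pderiv c (pderiv d (qD a b k (X l)))) (Ψ c d l) =
      (if c = b then if d = a then if l = k then TensorField.mk 1 (Ψ c d l) else 0 else 0 else 0) +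
      (if c = a then if d = b then if l = k then TensorField.mk 1 (Ψ c d l) else 0 else 0 else 0)
      := by
    intro c d l
    rw [qD_X]
    by_cases hl : l = k
    · simp only [if_pos hl, pderiv_pderiv_X_mul_X, TensorField.mk_add_left,
        apply_ite (fun p => TensorField.mk p (Ψ c d l)), mk_zero_left]
    · simp [hl, mk_zero_left]
  simp only [quadCocycle_apply, h, Finset.sum_add_distrib, Finset.sum_ite_eq', Finset.mem_univ,
    if_true, Finset.sum_ite_irrel, Finset.sum_const_zero]
  rw [hΨ b a k, two_smul]

/-- The cochain `Y ↦ div Y ⊗ v`. -/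
def divCocycle (v : V) : Vec m →ₗ[ℂ] TensorField m V where
  toFun Y := TensorField.mk (div Y) v
  map_add' Y Z := by
    simp only [div, Derivation.add_apply, map_add, Finset.sum_add_distrib,
      TensorField.mk_add_left]
  map_smul' c Y := by
    simp only [div, Derivation.smul_apply, Derivation.map_smul, ← Finset.smul_sum,
      TensorField.mk_smul_left, RingHom.id_apply]

lemma divCocycle_apply (v : V) (Y : Vec m) : divCocycle v Y = TensorField.mk (div Y) v := rfl

lemma div_D (i : Fin m) : div (D i) = 0 := by
  refine Finset.sum_eq_zero fun k _ => ?_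
  rw [D_X]
  split_ifs <;> simp

lemma div_xD (j i : Fin m) : div (xD j i) = if j = i then 1 else 0 := by
  have : ∀ k : Fin m, pderiv k (xD j i (X k)) = if k = i then if j = i then 1 else 0 else 0 := by
    intro k
    rw [xD_X]
    split_ifs with h1 h2 <;> simp_all [pderiv_X, eq_comm]
  simp [div, this]

lemma div_euler : div (euler m) = (m : MvPolynomial (Fin m) ℂ) := by
  simp [div, euler_X]

lemma divCocycle_ne_zero (hm : 1 < m) {v : V} (hv0 : v ≠ 0) : divCocycle (m := m) v ≠ 0 := by
  intro h
  have h1 := divCocycle_apply v (xD (fstIdx hm) (fstIdx hm))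
  rw [h, div_xD, if_pos rfl] at h1
  exact hv0 (mk_one_eq_zero.1 h1.symm)

variable [LieRingModule (linAlg m) V] [LieModule ℂ (linAlg m) V]

lemma pderiv_pderiv_apply (Y : Vec m) (a b : Fin m) (q : MvPolynomial (Fin m) ℂ) :
    pderiv a (pderiv b (Y q)) = Y (pderiv a (pderiv b q)) +
      (∑ l, pderiv a (Y (X l)) * pderiv l (pderiv b q)) +
      (∑ l, pderiv b (Y (X l)) * pderiv a (pderiv l q)) +
      ∑ l, pderiv a (pderiv b (Y (X l))) * pderiv l q := by
  rw [pderiv_apply Y b q, map_add, pderiv_apply Y a, map_sum]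
  simp only [Derivation.leibniz, smul_eq_mul, Finset.sum_add_distrib]
  simp only [mul_comm (pderiv _ q)]
  ring

/-- In each of the three fourfold sums, the summation index `l` is exchanged with one of the other
three. -/
lemma sum_exchange {G : Type*} [AddCommGroup G] (T : Fin m → Fin m → Fin m → G)
    (f g h : Fin m → Fin m → Fin m → Fin m → G) :
    ∑ a, ∑ b, ∑ k, (T a b k + (∑ l, f a b k l + ∑ l, g a b k l - ∑ l, h a b k l)) =
      ∑ a, ∑ b, ∑ k, (T a b k + ∑ l, f l b k a + ∑ l, g a l k b - ∑ l, h a b l k) := by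
  have e : ∀ F : Fin m → Fin m → Fin m → G,
      ∑ b, ∑ k, ∑ l, F b k l = ∑ l, ∑ b, ∑ k, F b k l := fun F =>
    (Finset.sum_congr rfl fun b _ => Finset.sum_comm).trans Finset.sum_comm
  have hf : ∑ a, ∑ b, ∑ k, ∑ l, f a b k l = ∑ a, ∑ b, ∑ k, ∑ l, f l b k a := by
    rw [Finset.sum_congr rfl fun a _ => e (f a), Finset.sum_comm]
    exact Finset.sum_congr rfl fun a _ => (e fun b k l => f l b k a).symm
  have hg : ∑ a, ∑ b, ∑ k, ∑ l, g a b k l = ∑ a, ∑ b, ∑ k, ∑ l, g a l k b := by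
    refine Finset.sum_congr rfl fun a _ => ?_
    rw [e, Finset.sum_congr rfl fun l _ => Finset.sum_comm]
  have hh : ∑ a, ∑ b, ∑ k, ∑ l, h a b k l = ∑ a, ∑ b, ∑ k, ∑ l, h a b l k :=
    Finset.sum_congr rfl fun a _ => Finset.sum_congr rfl fun b _ => Finset.sum_comm
  simp only [Finset.sum_add_distrib, Finset.sum_sub_distrib]
  rw [hf, hg, hh]
  abel

lemma lie_quadCocycle {Ψ : Fin m → Fin m → Fin m → V} (hΨ : IsQuadFamily (fibAct V) Ψ)
    (Y Z : Vec m) : ⁅Y, quadCocycle Ψ Z⁆ = ∑ a, ∑ b, ∑ k,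
      TensorField.mk (Y (pderiv a (pderiv b (Z (X k)))) +
        (∑ l, pderiv a (Y (X l)) * pderiv l (pderiv b (Z (X k)))) +
        (∑ l, pderiv b (Y (X l)) * pderiv a (pderiv l (Z (X k)))) -
        ∑ l, pderiv l (Y (X k)) * pderiv a (pderiv b (Z (X l)))) (Ψ a b k) := by
  have hact : ∀ a b k : Fin m, ∑ i, ∑ j, TensorField.mk
      (pderiv j (Y (X i)) * pderiv a (pderiv b (Z (X k)))) (fibAct V j i (Ψ a b k)) =
      ∑ l, TensorField.mk (pderiv l (Y (X a)) * pderiv a (pderiv b (Z (X k)))) (Ψ l b k) +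
      ∑ l, TensorField.mk (pderiv l (Y (X b)) * pderiv a (pderiv b (Z (X k)))) (Ψ a l k) -
      ∑ l, TensorField.mk (pderiv k (Y (X l)) * pderiv a (pderiv b (Z (X k)))) (Ψ a b l) := by
    intro a b k
    simp only [hΨ.equiv, TensorField.mk_sub_right, TensorField.mk_add_right,
      apply_ite (TensorField.mk _), TensorField.mk_zero_right, Finset.sum_sub_distrib,
      Finset.sum_add_distrib, Finset.sum_ite_irrel, Finset.sum_const_zero, Finset.sum_ite_eq,
      Finset.sum_ite_eq', Finset.mem_univ, if_true]
  simp only [quadCocycle_apply, lie_sum, lie_mk, hact]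
  rw [sum_exchange]
  simp only [TensorField.mk_add_left, TensorField.mk_sub_left, TensorField.mk_sum_left]

lemma quadCocycle_lie {Ψ : Fin m → Fin m → Fin m → V} (hΨ : IsQuadFamily (fibAct V) Ψ)
    (Y Z : Vec m) : quadCocycle Ψ ⁅Y, Z⁆ = ⁅Y, quadCocycle Ψ Z⁆ - ⁅Z, quadCocycle Ψ Y⁆ := by
  rw [lie_quadCocycle hΨ, lie_quadCocycle hΨ, quadCocycle_apply]
  simp only [← Finset.sum_sub_distrib, ← TensorField.mk_sub_left]
  refine Finset.sum_congr rfl fun a _ => Finset.sum_congr rfl fun b _ =>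
    Finset.sum_congr rfl fun k _ => ?_
  congr 1
  rw [Derivation.commutator_apply, map_sub, map_sub, pderiv_pderiv_apply Y a b (Z (X k)),
    pderiv_pderiv_apply Z a b (Y (X k))]
  have hcomm : ∀ Y Z : Vec m, ∑ l, pderiv a (pderiv b (Y (X l))) * pderiv l (Z (X k)) =
      ∑ l, pderiv l (Z (X k)) * pderiv a (pderiv b (Y (X l))) := fun Y Z =>
    Finset.sum_congr rfl fun l _ => mul_comm _ _
  rw [hcomm, hcomm]
  ring

lemma div_lie (Y Z : Vec m) : div ⁅Y, Z⁆ = Y (div Z) - Z (div Y) := by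
  have h : (∑ i, ∑ k, pderiv i (Y (X k)) * pderiv k (Z (X i))) =
      ∑ i, ∑ k, pderiv i (Z (X k)) * pderiv k (Y (X i)) := by
    rw [Finset.sum_comm]
    simp only [mul_comm]
  simp only [div, pderiv_lie_apply, Finset.sum_add_distrib, Finset.sum_sub_distrib, h, sub_self,
    add_zero, map_sum]

lemma divCocycle_mem {v : V} (hv : ∀ j i, fibAct (m := m) V j i v = 0) :
    divCocycle v ∈ relCocycle1 (TensorField m V) (constAlg m) (affAlg m) := by
  have hcoc : ∀ Y Z : Vec m, divCocycle v ⁅Y, Z⁆ = ⁅Y, divCocycle v Z⁆ - ⁅Z, divCocycle v Y⁆ := by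
    intro Y Z
    simp only [divCocycle_apply, lie_mk_of_invariant hv, ← TensorField.mk_sub_left, div_lie]
  have hD : ∀ i : Fin m, divCocycle v (D i) = 0 := fun i => by
    rw [divCocycle_apply, div_D, mk_zero_left]
  refine mem_relCocycle1_iff.2 ⟨fun Y hY => eq_zero_on_constAlg hD hY, fun Y hY Z => ?_, hcoc⟩
  have hinv : ⁅Z, divCocycle v Y⁆ = 0 := by
    refine eq_zero_on_affAlg
      (f := (LieModule.toEnd ℂ (Vec m) (TensorField m V) Z) ∘ₗ divCocycle v)
      (fun i => ?_) (fun j i => ?_) hY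
    · rw [LinearMap.comp_apply, hD, map_zero]
    · change ⁅Z, divCocycle v (xD j i)⁆ = 0
      rw [divCocycle_apply, lie_mk_of_invariant hv, div_xD]
      split_ifs
      · rw [Derivation.map_one_eq_zero, mk_zero_left]
      · rw [map_zero, mk_zero_left]
  rw [hcoc, hinv, sub_zero]

end Explicit

/-! ### Cocycles with values in an irreducible tensor field module -/

section Classification

variable {m : ℕ} (hm : 1 < m) {lam : Fin m → ℂ} {V : Type*} [AddCommGroup V] [Module ℂ V]
  [LieRingModule (linAlg m) V] [LieModule ℂ (linAlg m) V]

lemma quadCocycle_mem {Ψ : Fin m → Fin m → Fin m → V} (hΨ : IsQuadFamily (fibAct V) Ψ) :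
    quadCocycle Ψ ∈ relCocycle1 (TensorField m V) (constAlg m) (affAlg m) := by
  have h := mem_relCocycle1_iff.1 (mem_relCocycle1_of_vanish (k := affAlg m)
    (fun Y hY => eq_zero_on_affAlg (quadCocycle_D Ψ) (quadCocycle_xD Ψ) hY) (quadCocycle_lie hΨ))
  exact mem_relCocycle1_iff.2
    ⟨fun Y hY => eq_zero_on_constAlg (quadCocycle_D Ψ) hY, h.2.1, h.2.2⟩

lemma sum_eLast : ∑ i, eLast hm i = 1 := by
  simp [eLast_apply]

lemma sum_corner : ∑ i, (2 • eLast hm - eFirst hm) i = 1 := by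
  simp only [Pi.sub_apply, Pi.smul_apply, Finset.sum_sub_distrib, ← Finset.smul_sum,
    eLast_apply, eFirst_apply, Finset.sum_ite_eq', Finset.mem_univ, if_true]
  norm_num

lemma eLast_ne_corner : eLast hm ≠ 2 • eLast hm - eFirst hm := by
  intro h
  have := congrFun h (fstIdx hm)
  simp [eLast_apply, eFirst_apply, -Fin.mk.injEq, fstIdx_ne_lstIdx hm] at this

lemma IsQuadFamily.eq_zero {Φ : Fin m → Fin m → Fin m → V}
    (hΦ : IsQuadFamily (fibAct V) Φ) (h1 : Φ (lstIdx hm) (lstIdx hm) (fstIdx hm) = 0)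
    (h2 : ∑ i, Φ (lstIdx hm) i i = 0) (a b k : Fin m) : Φ a b k = 0 := by
  have hK : IsStable (fibAct (m := m) V) (⊥ : Submodule ℂ V) := by
    intro j i x hx
    rw [(Submodule.mem_bot ℂ).1 hx, map_zero]
    exact zero_mem _
  exact (Submodule.mem_bot ℂ).1 (hΦ.mem hK (fstIdx_ne_lstIdx hm)
    ((Submodule.mem_bot ℂ).2 h1) ((Submodule.mem_bot ℂ).2 h2) a b k)

lemma quadCocycle_ne_zero {Ψ : Fin m → Fin m → Fin m → V} (hΨ : IsQuadFamily (fibAct V) Ψ)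
    {a b k : Fin m} (h : Ψ a b k ≠ 0) : quadCocycle Ψ ≠ 0 := by
  intro h0
  have h1 := quadCocycle_qD hΨ.symm a b k
  rw [h0, LinearMap.zero_apply] at h1
  exact h (mk_one_eq_zero.1 ((smul_eq_zero.1 h1.symm).resolve_left two_ne_zero))

namespace IsLowestWeightIrreducible

variable (hV : IsLowestWeightIrreducible V lam)
include hV

/-- The value of a homomorphism from the quadratic fields at `x_m^2 D_1`. -/
lemma corner_mem {v : V} (hv : IsLowest (fibAct V) lam v) (hv0 : v ≠ 0)
    {Φ : Fin m → Fin m → Fin m → V} (hΦ : IsQuadFamily (fibAct V) Φ) :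
    (lam = 2 • eLast hm - eFirst hm ∧
      Φ (lstIdx hm) (lstIdx hm) (fstIdx hm) ∈ Submodule.span ℂ {v}) ∨
    Φ (lstIdx hm) (lstIdx hm) (fstIdx hm) = 0 := by
  by_cases h0 : Φ (lstIdx hm) (lstIdx hm) (fstIdx hm) = 0
  · exact Or.inr h0
  · have h := hv.unique isGlRep_fibAct hV.eq_bot_or_top hv0 (hΦ.isLowest_corner hm) h0
    exact Or.inl ⟨h.1.symm, h.2⟩

/-- The value of a homomorphism from the quadratic fields at `x_m E`. -/
lemma trace_mem {v : V} (hv : IsLowest (fibAct V) lam v) (hv0 : v ≠ 0)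
    {Φ : Fin m → Fin m → Fin m → V} (hΦ : IsQuadFamily (fibAct V) Φ) :
    (lam = eLast hm ∧ ∑ i, Φ (lstIdx hm) i i ∈ Submodule.span ℂ {v}) ∨
    ∑ i, Φ (lstIdx hm) i i = 0 := by
  by_cases h0 : ∑ i, Φ (lstIdx hm) i i = 0
  · exact Or.inr h0
  · have h := hv.unique isGlRep_fibAct hV.eq_bot_or_top hv0
      (isLowest_last hm (u := fun b => ∑ i, Φ b i i) hΦ.equiv_trace) h0
    exact Or.inl ⟨h.1.symm, h.2⟩

/-- Away from the three exceptional weights there are no cocycles. -/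
lemma cocycle_eq_zero (h0 : lam ≠ 0) (h1 : lam ≠ eLast hm)
    (h2 : lam ≠ 2 • eLast hm - eFirst hm)
    {w : Vec m →ₗ[ℂ] TensorField m V}
    (hw : w ∈ relCocycle1 (TensorField m V) (constAlg m) (affAlg m)) : w = 0 := by
  by_cases hc : ∃ d : ℕ, (d : ℂ) = ∑ i, lam i
  · obtain ⟨d, hd⟩ := hc
    rcases (by omega : d = 0 ∨ d = 1 ∨ 2 ≤ d) with rfl | rfl | hd2
    · refine eq_zero_of_linear hw hV.euler_act (by rw [← hd, Nat.cast_zero]) fun j i => ?_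
      obtain ⟨v, hv, hinv⟩ := exists_invariant hw j i
      rw [hv, hV.eq_zero_of_invariant h0 hinv, TensorField.mk_zero_right]
    · have hc1 : ∑ i, lam i = 1 := by rw [← hd, Nat.cast_one]
      obtain ⟨Φ, hΦ, hΦw⟩ := exists_quadFamily hw hV.euler_act hc1
      obtain ⟨v, hv0, hv⟩ := hV.exists_isLowest
      refine eq_zero_of_quadratic hw hV.euler_act hc1 fun a b k => ?_
      rw [hΦw, hΦ.eq_zero hm
        ((hV.corner_mem hm hv hv0 hΦ).resolve_left fun h => h2 h.1)
        ((hV.trace_mem hm hv hv0 hΦ).resolve_left fun h => h1 h.1), TensorField.mk_zero_right]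
    · exact eq_zero_of_two_le hw hm hV.euler_act hd2 hd
  · exact eq_zero_of_vanish hw hV.euler_act fun d hd => absurd ⟨d, hd⟩ hc

/-- If `c = 1` and the two lowest weight components of every homomorphism from the quadratic
fields are proportional to those of `Ψ`, the cocycle of `Ψ` spans all cocycles. -/
lemma exists_eq_smul_quadCocycle (hc : ∑ i, lam i = 1) {Ψ : Fin m → Fin m → Fin m → V}
    (hΨ : IsQuadFamily (fibAct V) Ψ)
    (hprop : ∀ Φ, IsQuadFamily (fibAct V) Φ → ∃ t : ℂ,
      Φ (lstIdx hm) (lstIdx hm) (fstIdx hm) = t • Ψ (lstIdx hm) (lstIdx hm) (fstIdx hm) ∧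
      ∑ i, Φ (lstIdx hm) i i = t • ∑ i, Ψ (lstIdx hm) i i)
    {w : Vec m →ₗ[ℂ] TensorField m V}
    (hw : w ∈ relCocycle1 (TensorField m V) (constAlg m) (affAlg m)) :
    ∃ t : ℂ, w = t • quadCocycle Ψ := by
  obtain ⟨Φ, hΦ, hΦw⟩ := exists_quadFamily hw hV.euler_act hc
  obtain ⟨t, ht1, ht2⟩ := hprop Φ hΦ
  have hz := (hΦ.sub (hΨ.smul t)).eq_zero hm (by rw [ht1, sub_self])
    (by rw [Finset.sum_sub_distrib, ← Finset.smul_sum, ht2, sub_self])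
  -- `quadCocycle Ψ` takes the value `2 Ψ a b k` at `x_a x_b D_k`
  refine ⟨t / 2, sub_eq_zero.1 (eq_zero_of_quadratic
    (sub_mem hw (Submodule.smul_mem _ (t / 2) (quadCocycle_mem hΨ))) hV.euler_act hc
    fun a b k => ?_)⟩
  rw [LinearMap.sub_apply, LinearMap.smul_apply, hΦw, quadCocycle_qD hΨ.symm, smul_smul,
    div_mul_cancel₀ t two_ne_zero, ← mk_smul_right, sub_eq_zero.1 (hz a b k), sub_self]

lemma exists_cocycle_last (hlam : lam = eLast hm) :
    ∃ w ∈ relCocycle1 (TensorField m V) (constAlg m) (affAlg m), w ≠ 0 ∧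
      ∀ w' ∈ relCocycle1 (TensorField m V) (constAlg m) (affAlg m), ∃ c : ℂ, w' = c • w := by
  obtain ⟨v, hv0, hv⟩ := hV.exists_isLowest
  obtain ⟨Ψ, hΨ, h1, h2⟩ := hV.exists_quadFamily_last hm hlam hv hv0
  have hne : ∃ i, Ψ (lstIdx hm) i i ≠ 0 := by
    by_contra! h
    exact hv0 (by rw [← h2, Finset.sum_eq_zero fun i _ => h i])
  obtain ⟨i, hi⟩ := hne
  refine ⟨_, quadCocycle_mem hΨ, quadCocycle_ne_zero hΨ hi, fun w' hw' =>
    hV.exists_eq_smul_quadCocycle hm (hlam ▸ sum_eLast hm) hΨ (fun Φ hΦ => ?_) hw'⟩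
  have hc := (hV.corner_mem hm hv hv0 hΦ).resolve_left fun h =>
    eLast_ne_corner hm (hlam.symm.trans h.1)
  have ht : ∑ i, Φ (lstIdx hm) i i ∈ Submodule.span ℂ {v} := by
    rcases hV.trace_mem hm hv hv0 hΦ with h | h
    · exact h.2
    · rw [h]; exact zero_mem _
  obtain ⟨t, ht⟩ := Submodule.mem_span_singleton.1 ht
  exact ⟨t, by rw [hc, h1, smul_zero], by rw [h2, ht]⟩

lemma exists_cocycle_corner (hlam : lam = 2 • eLast hm - eFirst hm) :
    ∃ w ∈ relCocycle1 (TensorField m V) (constAlg m) (affAlg m), w ≠ 0 ∧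
      ∀ w' ∈ relCocycle1 (TensorField m V) (constAlg m) (affAlg m), ∃ c : ℂ, w' = c • w := by
  obtain ⟨v, hv0, hv⟩ := hV.exists_isLowest
  obtain ⟨Ψ, hΨ, h1, h2⟩ := hV.exists_quadFamily_corner hm hlam hv hv0
  refine ⟨_, quadCocycle_mem hΨ, quadCocycle_ne_zero hΨ (h1.trans_ne hv0), fun w' hw' =>
    hV.exists_eq_smul_quadCocycle hm (hlam ▸ sum_corner hm) hΨ (fun Φ hΦ => ?_) hw'⟩
  have ht := (hV.trace_mem hm hv hv0 hΦ).resolve_left fun h =>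
    eLast_ne_corner hm (h.1.symm.trans hlam)
  have hc : Φ (lstIdx hm) (lstIdx hm) (fstIdx hm) ∈ Submodule.span ℂ {v} := by
    rcases hV.corner_mem hm hv hv0 hΦ with h | h
    · exact h.2
    · rw [h]; exact zero_mem _
  obtain ⟨t, hc⟩ := Submodule.mem_span_singleton.1 hc
  exact ⟨t, by rw [h1, hc], by rw [ht, h2, smul_zero]⟩

lemma exists_eq_smul_divCocycle (hm : 1 < m) (hlam : lam = 0) {v : V} (hv0 : v ≠ 0)
    {w : Vec m →ₗ[ℂ] TensorField m V}
    (hw : w ∈ relCocycle1 (TensorField m V) (constAlg m) (affAlg m)) :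
    ∃ c : ℂ, w = c • divCocycle v := by
  obtain ⟨u, hu, -⟩ := exists_invariant hw (fstIdx hm) (fstIdx hm)
  obtain ⟨t, rfl⟩ := Submodule.mem_span_singleton.1 (hV.mem_span_of_zero hlam hv0 u)
  refine ⟨t, sub_eq_zero.1 (eq_zero_of_linear (sub_mem hw (Submodule.smul_mem _ t
    (divCocycle_mem fun j i => hV.trivial_of_zero hlam j i v))) hV.euler_act (by simp [hlam])
    fun j i => ?_)⟩
  rw [LinearMap.sub_apply, LinearMap.smul_apply, apply_xD_eq_trace hw j i (fstIdx hm), hu,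
    divCocycle_apply, div_xD]
  split_ifs
  · rw [mk_smul_right, sub_self]
  · rw [mk_zero_left, smul_zero, sub_self]

lemma cocycle_le_affine (hc : ∑ i, lam i = 1) :
    relCocycle1 (TensorField m V) (constAlg m) (affAlg m) ≤
      relCocycle1 (TensorField m V) (affAlg m) (affAlg m) := fun _ hw =>
  mem_relCocycle1_of_vanish
    (fun _ hY => eq_zero_on_affAlg (apply_D hw) (apply_xD_eq_zero hw hV.euler_act hc) hY)
    (mem_relCocycle1_iff.1 hw).2.2

lemma cocycle_le_projective (hlam : lam = 2 • eLast hm - eFirst hm) :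
    relCocycle1 (TensorField m V) (constAlg m) (affAlg m) ≤
      relCocycle1 (TensorField m V) (projAlg m) (projAlg m) := by
  intro w hw
  have hc : ∑ i, lam i = 1 := hlam ▸ sum_corner hm
  obtain ⟨Φ, hΦ, hΦw⟩ := exists_quadFamily hw hV.euler_act hc
  obtain ⟨v, hv0, hv⟩ := hV.exists_isLowest
  have ht := (hV.trace_mem hm hv hv0 hΦ).resolve_left fun h =>
    eLast_ne_corner hm (h.1.symm.trans hlam)
  have hE : ∀ j, w (xE j) = 0 := by
    intro j
    have h := hΦ.equiv_trace j (lstIdx hm) (lstIdx hm)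
    rw [ht, map_zero, if_pos rfl] at h
    rw [← sum_qD, map_sum, Finset.sum_congr rfl fun i _ => hΦw j i i, ← mk_sum_right, ← h,
      TensorField.mk_zero_right]
  exact mem_relCocycle1_of_vanish
    (fun Y hY => eq_zero_on_projAlg (apply_D hw) (apply_xD_eq_zero hw hV.euler_act hc) hE hY)
    (mem_relCocycle1_iff.1 hw).2.2

end IsLowestWeightIrreducible

end Classification

end VecCohomology

end

open VecCohomology in
theorem mainTheorem3 {m : ℕ} (hm : 1 < m) (lam : Fin m → ℂ)
    (V : Type*) [AddCommGroup V] [Module ℂ V] [LieRingModule (linAlg m) V]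
    [LieModule ℂ (linAlg m) V] (hV : IsLowestWeightIrreducible V lam) :
    ((lam = 0 ∨ lam = eLast hm ∨ lam = 2 • eLast hm - eFirst hm) →
      Module.rank ℂ (RelH1 (TensorField m V) (constAlg m) (affAlg m)) = 1) ∧
    (¬ (lam = 0 ∨ lam = eLast hm ∨ lam = 2 • eLast hm - eFirst hm) →
      Module.rank ℂ (RelH1 (TensorField m V) (constAlg m) (affAlg m)) = 0) ∧
    (lam = 0 → ∀ v : V, v ≠ 0 →
      ∃ w : relCocycle1 (TensorField m V) (constAlg m) (affAlg m),
        (∀ Y : Vec m, w.1 Y = TensorField.mk (div Y) v) ∧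
        Submodule.span ℂ {(Submodule.Quotient.mk w :
          RelH1 (TensorField m V) (constAlg m) (affAlg m))} = ⊤) ∧
    div (euler m) = (m : MvPolynomial (Fin m) ℂ) ∧
    (lam = eLast hm →
      relCocycle1 (TensorField m V) (constAlg m) (affAlg m) ≤
        relCocycle1 (TensorField m V) (affAlg m) (affAlg m)) ∧
    (lam = 2 • eLast hm - eFirst hm →
      relCocycle1 (TensorField m V) (constAlg m) (affAlg m) ≤
        relCocycle1 (TensorField m V) (projAlg m) (projAlg m)) := by
  have hone : (∃ w ∈ relCocycle1 (TensorField m V) (constAlg m) (affAlg m), w ≠ 0 ∧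
      ∀ w' ∈ relCocycle1 (TensorField m V) (constAlg m) (affAlg m), ∃ c : ℂ, w' = c • w) →
      Module.rank ℂ (RelH1 (TensorField m V) (constAlg m) (affAlg m)) = 1 := by
    rintro ⟨w, hw, hw0, hall⟩
    refine rank_relH1_eq_one relCoboundary1_affAlg (w := ⟨w, hw⟩)
      (fun h => hw0 (congrArg Subtype.val h)) fun w' => ?_
    obtain ⟨c, hc⟩ := hall w'.1 w'.2
    exact ⟨c, Subtype.ext hc⟩
  refine ⟨?_, fun h => ?_, fun hlam v hv0 => ?_, div_euler, fun hlam => ?_, fun hlam => ?_⟩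
  · rintro (hlam | hlam | hlam)
    · obtain ⟨v, hv0, -⟩ := hV.exists_isLowest
      exact hone ⟨divCocycle v, divCocycle_mem fun j i => hV.trivial_of_zero hlam j i v,
        divCocycle_ne_zero hm hv0,
        fun w' hw' => hV.exists_eq_smul_divCocycle hm hlam hv0 hw'⟩
    · exact hone (hV.exists_cocycle_last hm hlam)
    · exact hone (hV.exists_cocycle_corner hm hlam)
  · push Not at h
    exact rank_relH1_eq_zero fun w hw => hV.cocycle_eq_zero hm h.1 h.2.1 h.2.2 hw
  · refine ⟨⟨divCocycle v, divCocycle_mem fun j i => hV.trivial_of_zero hlam j i v⟩,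
      fun Y => rfl, relH1_span_eq_top fun w' => ?_⟩
    obtain ⟨c, hc⟩ := hV.exists_eq_smul_divCocycle hm hlam hv0 w'.2
    exact ⟨c, Subtype.ext hc⟩
  · exact hV.cocycle_le_affine (hlam ▸ sum_eLast hm)
  · exact hV.cocycle_le_projective hm hlam
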